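/- **Setting.** For $n\ge 0$ let $W_n$ be the Weyl group of type $B_n$: the group of permutations $\sigma$ of $\{-n,\dots,-1,0,1,\dots,n\}$ with $\sigma(-x)=-\sigma(x)$ for all $x$. Its simple reflections are $S=\{s_0,\dots,s_{n-1}\}$, where $s_0=(-1\ \,1)$ and $s_i=(i\ \,i{+}1)(-i\ \,{-i}{-}1)$ for $i>0$; $\ell$ is the Coxeter length. For $I\subset S$ let $W_I=\langle I\rangle$ be the parabolic subgroup, with longest element $w_I$. An $(I,J)$-coset is a double coset $p\in W_I\backslash W_n/W_J$, with minimal element $\underline p$ and maximal element $\overline p$. It is a *core coset* if $I\cap\underline pJ\underline p^{-1}=I$ and $\underline p^{-1}I\underline p\cap J=J$. For an $(I,J)$-coset $p$ and a $(J,K)$-coset $q$ put $p*q=W_I(\overline p*\overline q)W_K$, where $*$ on the right is the product in the Coxeter (0-Hecke) monoid. This composition is *reduced*, written $p.q$, if $\overline p*\overline q=(\overline pw_J^{-1})\,\overline q=\overline p\,(w_J^{-1}\overline q)$ and lengths add in both of these products of two factors. In a Coxeter group, $x.y$ denotes the product $xy$ when $\ell(xy)=\ell(x)+\ell(y)$ (a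 reduced composition). An $(I,J)$-expression is a sequence $[I=I_0,I_1,\dots,I_d=J]$ of subsets of $S$ in which consecutive members differ by adding or removing one simple reflection. It is a *reduced expression* for the $(I,J)$-coset $p$ if $\overline p=w_{I_0}\prod_i w_{I_{i-1}}^{-1}w_{I_i}$ and $\ell(\overline p)=\ell(w_{I_0})+\sum_i\bigl(\ell(w_{I_i})-\ell(w_{I_{i-1}})\bigr)$, where $i$ runs in order over the steps with $I_{i-1}\subset I_i$. An $(I,J)$-coset is *atomic* if it is a core coset with a reduced expression of the form $[I,I\cup\{s\},J]$, where $s\notin I$ and $J=(I\cup\{s\})\setminus\{t\}$. An *atomic reduced expression* for $p$ is a reduced expression $[I_0,K_1,I_1,K_2,\dots,K_r,I_r]$ for $p$ ($r\ge 0$) in which every $[I_{i-1},K_i,I_i]$ is a reduced expression of an atomic coset. For $J\subset S$ let $\sim_J$ be the equivalence relation on $\{-n,\dots,n\}$ generated by $j\sim_J j+1$ and $-j\sim_J -j-1$ for $s_j\in J$. With $k=n-\#J$, its classes are labelled in increasing order $C_{-k}^{(J)},\dots,C_0^{(J)},\dots,C_k^{(J)}$, with $0\in C_0^{(J)}$.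 An element $y\in W_n$ is a *block permutation* relative to $I$ and $J$ if each $C_c^{(J)}$ is sent by an order-preserving bijection onto some $C_{c'}^{(I)}$. If $\#I=\#J=n-k$, such a $y$ induces the permutation $\mathbb Sq(y)\colon c\mapsto c'$ of $\{-k,\dots,k\}$, which lies in $W_k$. For a core $(I,J)$-coset $p$ put $\mathbb Sq(p)=\mathbb Sq(\underline p)$. **Theorem.** Fix $J\subset S$ of size $m$ and let $k=n-m$. 1. If $p$ is a core $(I,J)$-coset, then $\#I=m$ and $\underline p$ is a block permutation relative to $I$ and $J$, so that $\mathbb Sq(p)\in W_k$ is defined. 2. If $p'$ is a core $(I,J)$-coset, $p''$ is a core $(J,K)$-coset and the composition $p=p'.p''$ is reduced, then $p$ is a core coset and $\mathbb Sq(p)=\mathbb Sq(p').\mathbb Sq(p'')$ is a reduced composition in $W_k$. 3. The map $(I,p)\mapsto\mathbb Sq(p)$ is a bijection from $\{(I,p)\mid I\subset S,\ p\text{ is a core }(I,J)\text{-coset}\}$ to $W_k$. 4. This bijection restricts to a bijection between the atomic $(I,J)$-cosets (as $I$ varies) and the simple reflections of $W_k$. 5. For every core $(I,J)$-coset $p$,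 the map which sends $[I_0,K_1,I_1,\dots,K_r,I_r]$ to the word $(\mathbb Sq(a_1),\dots,\mathbb Sq(a_r))$, where $a_i$ is the $(I_{i-1},I_i)$-coset containing $w_{K_i}$, is a bijection from the atomic reduced expressions for $p$ to the ordinary reduced expressions for $\mathbb Sq(p)$ in the simple reflections of $W_k$. -/

import Mathlib

noncomputable section

namespace TypeB

/-! ### The Weyl group of type `B_n` as a group of signed permutations -/

/-- The ordered set `{-n, …, -1, 0, 1, …, n}`. -/
abbrev Pt (n : ℕ) : Type := {x : ℤ // |x| ≤ (n : ℤ)}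

instance (n : ℕ) : Neg (Pt n) := ⟨fun x => ⟨-x.1, by rw [abs_neg]; exact x.2⟩⟩

instance (n : ℕ) : Finite (Pt n) := by
  refine ((Set.finite_Icc (-(n : ℤ)) (n : ℤ)).subset ?_ : Set.Finite {x : ℤ | |x| ≤ (n : ℤ)})
  intro x hx
  exact abs_le.mp hx

theorem Pt.coe_neg {n : ℕ} (x : Pt n) : ((-x : Pt n) : ℤ) = -(x : ℤ) := rfl

theorem Pt.neg_neg {n : ℕ} (x : Pt n) : - -x = x := Subtype.ext (_root_.neg_neg x.1)

theorem Pt.neg_inj {n : ℕ} {x y : Pt n} : -x = -y ↔ x = y :=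
  ⟨fun h => by rw [← Pt.neg_neg x, h, Pt.neg_neg], fun h => by rw [h]⟩

/-- The permutations `σ` of `{-n, …, n}` with `σ (-x) = - σ x`. -/
def weylGroup (n : ℕ) : Subgroup (Equiv.Perm (Pt n)) where
  carrier := {σ | ∀ x, σ (-x) = -σ x}
  mul_mem' := by
    intro a b ha hb
    change ∀ x, a (-x) = -a x at ha
    change ∀ x, b (-x) = -b x at hb
    change ∀ x, (a * b) (-x) = -(a * b) x
    intro x
    rw [Equiv.Perm.mul_apply, Equiv.Perm.mul_apply, hb, ha]
  one_mem' := fun _ => rfl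
  inv_mem' := by
    intro a ha
    change ∀ x, a (-x) = -a x at ha
    change ∀ x, a⁻¹ (-x) = -a⁻¹ x
    intro x
    rw [Equiv.Perm.inv_eq_iff_eq, ha]
    simp

/-- The Weyl group of type `B_n`. -/
abbrev W (n : ℕ) : Type := weylGroup n

/-- The point `i` of `{-n, …, n}` for `0 ≤ i < n`. -/
def pt {n : ℕ} (i : Fin n) : Pt n := ⟨(i : ℤ), by
  have := i.2
  rw [abs_of_nonneg (by positivity)]; omega⟩

/-- The point `i + 1` of `{-n, …, n}` for `0 ≤ i < n`. -/
def ptSucc {n : ℕ} (i : Fin n) : Pt n := ⟨(i : ℤ) + 1, by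
  have := i.2
  rw [abs_of_nonneg (by positivity)]; omega⟩

/-- The permutation `(-1 1)` if `i = 0`, and `(i i+1)(-i -i-1)` if `i > 0`. -/
def simplePerm {n : ℕ} (i : Fin n) : Equiv.Perm (Pt n) :=
  if (i : ℕ) = 0 then Equiv.swap (-ptSucc i) (ptSucc i)
  else Equiv.swap (pt i) (ptSucc i) * Equiv.swap (-pt i) (-ptSucc i)

theorem swap_neg {n : ℕ} (a b x : Pt n) :
    Equiv.swap a b (-x) = -Equiv.swap (-a) (-b) x := by
  have h1 : ∀ c : Pt n, (-x = c) ↔ (x = -c) := fun c => by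
    rw [← Pt.neg_inj, Pt.neg_neg]
  rw [Equiv.swap_apply_def, Equiv.swap_apply_def]
  simp only [h1]
  split_ifs <;> simp [Pt.neg_neg]

theorem simplePerm_mem {n : ℕ} (i : Fin n) : simplePerm i ∈ weylGroup n := by
  intro x
  unfold simplePerm
  split_ifs with h
  · rw [swap_neg, Pt.neg_neg, Equiv.swap_comm]
  · have hd : Equiv.swap (pt i) (ptSucc i) * Equiv.swap (-pt i) (-ptSucc i)
        = Equiv.swap (-pt i) (-ptSucc i) * Equiv.swap (pt i) (ptSucc i) := by
      apply Equiv.Perm.Disjoint.commute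
      have e1 : pt i ≠ -pt i := fun e => h (by have := congrArg Subtype.val e; simp [pt, Pt.coe_neg] at this; omega)
      have e2 : pt i ≠ -ptSucc i := fun e => by
        have := congrArg Subtype.val e; simp [pt, ptSucc, Pt.coe_neg] at this; omega
      have e3 : ptSucc i ≠ -pt i := fun e => by
        have := congrArg Subtype.val e; simp [pt, ptSucc, Pt.coe_neg] at this; omega
      have e4 : ptSucc i ≠ -ptSucc i := fun e => by
        have := congrArg Subtype.val e; simp [ptSucc, Pt.coe_neg] at this; omega
      intro z
      by_cases hz : z = pt i ∨ z = ptSucc i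
      · right
        rcases hz with rfl | rfl
        · exact Equiv.swap_apply_of_ne_of_ne e1 e2
        · exact Equiv.swap_apply_of_ne_of_ne e3 e4
      · left
        push Not at hz
        exact Equiv.swap_apply_of_ne_of_ne hz.1 hz.2
    rw [Equiv.Perm.mul_apply, swap_neg, swap_neg, Pt.neg_neg, Pt.neg_neg,
      ← Equiv.Perm.mul_apply, ← hd]

/-- The simple reflections `s_0, …, s_{n-1}`. -/
def simple {n : ℕ} (i : Fin n) : W n := ⟨simplePerm i, simplePerm_mem i⟩

/-- The Coxeter length: the least length of a word in the simple reflections with product `w`. -/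
def len {n : ℕ} (w : W n) : ℕ :=
  sInf {d | ∃ ω : List (Fin n), ω.length = d ∧ (ω.map simple).prod = w}

/-- `w` is a product of a word `ω` of length `len w`. -/
def IsReducedWord {n : ℕ} (w : W n) (ω : List (Fin n)) : Prop :=
  (ω.map simple).prod = w ∧ ω.length = len w

open scoped Classical in
/-- A chosen reduced word of `w`. -/
def reducedWord {n : ℕ} (w : W n) : List (Fin n) :=
  if h : ∃ ω, IsReducedWord w ω then h.choose else []

/-- The product `s_i * w` in the Coxeter (0-Hecke) monoid: the longer one of `s_i w` and `w`. -/
def starSimple {n : ℕ} (i : Fin n) (w : W n) : W n :=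
  if len w < len (simple i * w) then simple i * w else w

/-- The product `x * y` in the Coxeter (0-Hecke) monoid, whose underlying set is identified with
`W n`. It does not depend on the chosen reduced word of `x`. -/
def star {n : ℕ} (x y : W n) : W n := (reducedWord x).foldr starSimple y

open scoped Classical in
/-- The element of minimal length of a set (used for double cosets, where it is unique). -/
def minElt {n : ℕ} (A : Set (W n)) : W n :=
  if h : A.Nonempty then (Set.exists_min_image A len A.toFinite h).choose else 1

open scoped Classical in
/-- The element of maximal length of a set (used for double cosets and parabolic subgroups,
where it is unique). -/
def maxElt {n : ℕ} (A : Set (W n)) : W n :=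
  if h : A.Nonempty then (Set.exists_max_image A len A.toFinite h).choose else 1

/-! ### Double cosets, core cosets, atomic cosets

Subsets of `S = {s_0, …, s_{n-1}}` are written as sets of indices. -/

/-- The parabolic subgroup `W_I`. -/
def parabolic {n : ℕ} (I : Finset (Fin n)) : Subgroup (W n) :=
  Subgroup.closure (simple '' (I : Set (Fin n)))

/-- The longest element `w_I` of `W_I`. -/
def longest {n : ℕ} (I : Finset (Fin n)) : W n := maxElt (parabolic I : Set (W n))

/-- An `(I,J)`-coset: an element of `W_I \ W / W_J`. -/
@[ext] structure Coset {n : ℕ} (I J : Finset (Fin n)) where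
  carrier : Set (W n)
  isDoubleCoset : ∃ w : W n,
    carrier = DoubleCoset.doubleCoset w (parabolic I : Set (W n)) (parabolic J : Set (W n))

/-- The `(I,J)`-coset containing `w`. -/
def cosetOf {n : ℕ} (I J : Finset (Fin n)) (w : W n) : Coset I J :=
  ⟨DoubleCoset.doubleCoset w (parabolic I : Set (W n)) (parabolic J : Set (W n)), w, rfl⟩

namespace Coset

variable {n : ℕ} {I J K : Finset (Fin n)}

/-- The minimal element of a double coset. -/
def min (p : Coset I J) : W n := minElt p.carrier

/-- The maximal element of a double coset. -/
def max (p : Coset I J) : W n := maxElt p.carrier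

/-- The left redundancy `I ∩ p_min J p_min⁻¹`. -/
def leftRed (p : Coset I J) : Set (Fin n) :=
  {i | i ∈ I ∧ ∃ j ∈ J, simple i = p.min * simple j * p.min⁻¹}

/-- The right redundancy `p_min⁻¹ I p_min ∩ J`. -/
def rightRed (p : Coset I J) : Set (Fin n) :=
  {j | j ∈ J ∧ ∃ i ∈ I, simple j = p.min⁻¹ * simple i * p.min}

/-- `p` is a core coset. -/
def IsCore (p : Coset I J) : Prop :=
  p.leftRed = (I : Set (Fin n)) ∧ p.rightRed = (J : Set (Fin n))

/-- The composition `p * q = W_I (p_max * q_max) W_K` in the singular Coxeter monoid. -/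
def comp (p : Coset I J) (q : Coset J K) : Coset I K := cosetOf I K (star p.max q.max)

/-- The composition `p * q` is reduced:
`(p_max w_J⁻¹) . q_max = p_max * q_max = p_max . (w_J⁻¹ q_max)`, where `x . y` stands for the
product `x y` together with the assertion that the lengths of `x` and `y` add up. -/
def IsReducedComp (p : Coset I J) (q : Coset J K) : Prop :=
  p.max * (longest J)⁻¹ * q.max = star p.max q.max ∧
  len (p.max * (longest J)⁻¹ * q.max) = len (p.max * (longest J)⁻¹) + len q.max ∧
  len (p.max * (longest J)⁻¹ * q.max) = len p.max + len ((longest J)⁻¹ * q.max)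

end Coset

/-! ### Expressions -/

/-- `K` arises from `I` by adding or removing one simple reflection. -/
def IsStep {n : ℕ} (I K : Finset (Fin n)) : Prop :=
  (∃ s, s ∉ I ∧ K = insert s I) ∨ (∃ s, s ∈ I ∧ K = I.erase s)

/-- `[I_0, …, I_d]` is a (singlestep) `(I,J)`-expression. -/
def IsExpr {n : ℕ} (I J : Finset (Fin n)) (L : List (Finset (Fin n))) : Prop :=
  L.head? = some I ∧ L.getLast? = some J ∧ L.IsChain IsStep

/-- The product of `w_I⁻¹ w_K` over all ascending steps `I ⊂ K` of the expression. -/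
def stepProd {n : ℕ} : List (Finset (Fin n)) → W n
  | I :: K :: L => (if I ⊆ K then (longest I)⁻¹ * longest K else 1) * stepProd (K :: L)
  | _ => 1

/-- The sum of `ℓ(w_K) - ℓ(w_I)` over all ascending steps `I ⊂ K` of the expression. -/
def stepLen {n : ℕ} : List (Finset (Fin n)) → ℤ
  | I :: K :: L =>
      (if I ⊆ K then (len (longest K) : ℤ) - len (longest I) else 0) + stepLen (K :: L)
  | _ => 0

/-- `L` is a reduced expression for the `(I,J)`-coset `p`. If `L` refines
`[[I = I_0 ⊂ K_1 ⊃ I_1 ⊂ ⋯ ⊂ K_r ⊃ I_r = J]]`, then the two equations read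
`p_max = w_{K_1} w_{I_1}⁻¹ w_{K_2} ⋯ w_{K_r}` and
`ℓ(p_max) = ℓ(w_{K_1}) - ℓ(w_{I_1}) + ℓ(w_{K_2}) - ⋯ + ℓ(w_{K_r})`. -/
def IsReducedExpr {n : ℕ} {I J : Finset (Fin n)} (p : Coset I J)
    (L : List (Finset (Fin n))) : Prop :=
  IsExpr I J L ∧ p.max = longest I * stepProd L ∧
    (len p.max : ℤ) = len (longest I) + stepLen L

/-- `p` is an atomic coset: a core coset with a reduced expression `[I + s - t] = [I, Is, J]`. -/
def Coset.IsAtomic {n : ℕ} {I J : Finset (Fin n)} (p : Coset I J) : Prop :=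
  p.IsCore ∧ ∃ s t : Fin n, s ∉ I ∧ t ∈ insert s I ∧
    IsReducedExpr p [I, insert s I, (insert s I).erase t]

/-- The expressions `[I_0, K_1, I_1, K_2, …, K_r, I_r]` such that each `[I_{i-1}, K_i, I_i]` is the
reduced expression of an atomic coset. -/
inductive IsAtomicExpr {n : ℕ} : List (Finset (Fin n)) → Prop
  | base (I : Finset (Fin n)) : IsAtomicExpr [I]
  | cons (I K I' : Finset (Fin n)) (L : List (Finset (Fin n))) (a : Coset I I')
      (ha : a.IsAtomic) (hK : IsReducedExpr a [I, K, I']) (hL : IsAtomicExpr (I' :: L)) :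
      IsAtomicExpr (I :: K :: I' :: L)

/-- `L` is an atomic reduced expression for `p`. -/
def IsAtomicReducedExpr {n : ℕ} {I J : Finset (Fin n)} (p : Coset I J)
    (L : List (Finset (Fin n))) : Prop :=
  IsReducedExpr p L ∧ IsAtomicExpr L

/-! ### Components and their labels -/

/-- The relations `j ∼ j + 1` and `-j ∼ -j - 1` for `s_j ∈ J`. -/
def adjRel {n : ℕ} (J : Finset (Fin n)) (x y : Pt n) : Prop :=
  ∃ j ∈ J, (x = pt j ∧ y = ptSucc j) ∨ (x = -pt j ∧ y = -ptSucc j)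

/-- The equivalence relation `∼_J` on `{-n, …, n}`; its classes are the components. -/
def compSetoid {n : ℕ} (J : Finset (Fin n)) : Setoid (Pt n) := Relation.EqvGen.setoid (adjRel J)

/-- The component of `x`. -/
def component {n : ℕ} (J : Finset (Fin n)) (x : Pt n) : Set (Pt n) := {z | compSetoid J z x}

/-- The number of `d` with `0 ≤ d < a` and `s_d ∉ J`. -/
def gaps {n : ℕ} (J : Finset (Fin n)) (a : ℕ) : ℕ :=
  (Finset.univ.filter fun d : Fin n => d ∉ J ∧ (d : ℕ) < a).card

/-- The label `c` of the component `C_c` of `x`, where the components are labelled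
`C_{-k}, …, C_{-1}, C_0, C_1, …, C_k` in increasing order and `C_0` contains `0`; the facts below
show that this is that labelling. -/
def labelInt {n : ℕ} (J : Finset (Fin n)) (x : Pt n) : ℤ := Int.sign x.1 * gaps J x.1.natAbs

theorem gaps_zero {n : ℕ} (J : Finset (Fin n)) : gaps J 0 = 0 := by simp [gaps]

theorem gaps_mono {n : ℕ} (J : Finset (Fin n)) : Monotone (gaps J) := by
  intro a b hab
  apply Finset.card_le_card
  intro d
  simp only [Finset.mem_filter, Finset.mem_univ, true_and]
  exact fun h => ⟨h.1, by omega⟩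

theorem gaps_top {n : ℕ} (J : Finset (Fin n)) : J.card + gaps J n = n := by
  have h : (Finset.univ.filter fun d : Fin n => d ∉ J ∧ (d : ℕ) < n) = Jᶜ := by
    ext d; simp
  unfold gaps
  rw [h, Finset.card_add_card_compl, Fintype.card_fin]

theorem gaps_succ {n : ℕ} (J : Finset (Fin n)) (d : Fin n) :
    gaps J (d + 1) = if d ∈ J then gaps J d else gaps J d + 1 := by
  unfold gaps
  split_ifs with h
  · congr 1
    ext e
    simp only [Finset.mem_filter, Finset.mem_univ, true_and, and_congr_right_iff]
    intro he
    have : (e : ℕ) ≠ d := fun hh => he (by rwa [Fin.ext hh])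
    omega
  · rw [← Finset.card_insert_of_notMem (a := d)]
    · congr 1
      ext e
      simp only [Finset.mem_filter, Finset.mem_univ, true_and, Finset.mem_insert]
      constructor
      · rintro ⟨h1, h2⟩
        by_cases hh : (e : ℕ) = d
        · exact Or.inl (Fin.ext hh)
        · exact Or.inr ⟨h1, by omega⟩
      · rintro (rfl | ⟨h1, h2⟩)
        · exact ⟨h, by omega⟩
        · exact ⟨h1, by omega⟩
    · simp

theorem labelInt_neg {n : ℕ} (J : Finset (Fin n)) (x : Pt n) :
    labelInt J (-x) = -labelInt J x := by
  simp [labelInt, Pt.coe_neg]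

theorem labelInt_of_nonneg {n : ℕ} (J : Finset (Fin n)) {x : Pt n} (hx : 0 ≤ x.1) :
    labelInt J x = gaps J x.1.natAbs := by
  rcases hx.eq_or_lt with h | h
  · rw [labelInt, ← h]; simp [gaps_zero]
  · rw [labelInt, Int.sign_eq_one_of_pos h, one_mul]

theorem labelInt_of_nonpos {n : ℕ} (J : Finset (Fin n)) {x : Pt n} (hx : x.1 ≤ 0) :
    labelInt J x = -gaps J x.1.natAbs := by
  have := labelInt_of_nonneg J (x := -x) (by rw [Pt.coe_neg]; omega)
  rw [labelInt_neg, Pt.coe_neg, Int.natAbs_neg] at this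
  omega

theorem labelInt_mono {n : ℕ} (J : Finset (Fin n)) {x y : Pt n} (h : x ≤ y) :
    labelInt J x ≤ labelInt J y := by
  have h' : x.1 ≤ y.1 := h
  rcases le_total 0 x.1 with hx | hx
  · rw [labelInt_of_nonneg J hx, labelInt_of_nonneg J (hx.trans h')]
    exact_mod_cast gaps_mono J (by omega)
  · rcases le_total 0 y.1 with hy | hy
    · rw [labelInt_of_nonpos J hx, labelInt_of_nonneg J hy]
      omega
    · rw [labelInt_of_nonpos J hx, labelInt_of_nonpos J hy]
      have := gaps_mono J (a := y.1.natAbs) (b := x.1.natAbs) (by omega)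
      omega

theorem compSetoid_neg {n : ℕ} {J : Finset (Fin n)} {x y : Pt n} (h : compSetoid J x y) :
    compSetoid J (-x) (-y) := by
  change Relation.EqvGen (adjRel J) x y at h
  change Relation.EqvGen (adjRel J) (-x) (-y)
  induction h with
  | rel x y h =>
    obtain ⟨j, hj, ⟨rfl, rfl⟩ | ⟨rfl, rfl⟩⟩ := h
    · exact .rel _ _ ⟨j, hj, Or.inr ⟨rfl, rfl⟩⟩
    · exact .rel _ _ ⟨j, hj, Or.inl ⟨Pt.neg_neg _, Pt.neg_neg _⟩⟩
  | refl x => exact .refl _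
  | symm x y _ ih => exact .symm _ _ ih
  | trans x y z _ _ ih1 ih2 => exact .trans _ _ _ ih1 ih2

theorem labelInt_ptSucc {n : ℕ} {J : Finset (Fin n)} {j : Fin n} (hj : j ∈ J) :
    labelInt J (pt j) = labelInt J (ptSucc j) := by
  rw [labelInt_of_nonneg J (x := pt j) (by simp [pt]),
    labelInt_of_nonneg J (x := ptSucc j) (by simp only [ptSucc]; omega)]
  have h1 : (pt j).1.natAbs = j := by simp [pt]
  have h2 : (ptSucc j).1.natAbs = j + 1 := by simp only [ptSucc]; omega
  rw [h1, h2, gaps_succ, if_pos hj]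

theorem compSetoid_of_gaps {n : ℕ} {J : Finset (Fin n)} (a b : ℕ) (ha : a ≤ n) (hab : a + b ≤ n)
    (h : gaps J a = gaps J (a + b)) :
    compSetoid J ⟨(a : ℤ), by rw [abs_of_nonneg (by positivity)]; omega⟩
      ⟨((a + b : ℕ) : ℤ), by rw [abs_of_nonneg (by positivity)]; omega⟩ := by
  induction b with
  | zero => exact .refl _
  | succ b ih =>
    have h1 := gaps_mono J (show a ≤ a + b by omega)
    have h2 := gaps_mono J (show a + b ≤ a + (b + 1) by omega)
    have hJ : (⟨a + b, by omega⟩ : Fin n) ∈ J := by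
      by_contra hn
      have := gaps_succ J ⟨a + b, by omega⟩
      rw [if_neg hn] at this
      simp only at this
      rw [← add_assoc] at h
      omega
    refine .trans _ _ _ (ih (by omega) (by omega)) (.rel _ _ ⟨_, hJ, Or.inl ⟨?_, ?_⟩⟩)
    · apply Subtype.ext; simp [pt]
    · apply Subtype.ext; simp [ptSucc]; ring

theorem compSetoid_of_nonneg {n : ℕ} {J : Finset (Fin n)} {x y : Pt n} (hx : 0 ≤ x.1)
    (hxy : x.1 ≤ y.1) (h : labelInt J x = labelInt J y) : compSetoid J x y := by
  rw [labelInt_of_nonneg J hx, labelInt_of_nonneg J (hx.trans hxy)] at h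
  have hy := abs_le.mp y.2
  have e : x.1.natAbs + (y.1.natAbs - x.1.natAbs) = y.1.natAbs := by omega
  have := compSetoid_of_gaps (J := J) x.1.natAbs (y.1.natAbs - x.1.natAbs) (by omega) (by omega)
    (by rw [e]; exact_mod_cast h)
  convert this using 1
  · apply Subtype.ext; simp only; omega
  · apply Subtype.ext; simp only; omega

/-- Two points have the same label exactly if they lie in the same component. -/
theorem labelInt_eq_iff {n : ℕ} (J : Finset (Fin n)) (x y : Pt n) :
    labelInt J x = labelInt J y ↔ compSetoid J x y := by
  constructor
  · intro h
    have key : ∀ x y : Pt n, 0 ≤ x.1 → 0 ≤ y.1 → labelInt J x = labelInt J y →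
        compSetoid J x y := by
      intro x y hx hy h
      rcases le_total x.1 y.1 with hxy | hxy
      · exact compSetoid_of_nonneg hx hxy h
      · exact (compSetoid J).symm (compSetoid_of_nonneg hy hxy h.symm)
    have keyneg : ∀ x y : Pt n, x.1 ≤ 0 → y.1 ≤ 0 → labelInt J x = labelInt J y →
        compSetoid J x y := by
      intro x y hx hy h
      have := compSetoid_neg (key (-x) (-y) (by rw [Pt.coe_neg]; omega)
        (by rw [Pt.coe_neg]; omega) (by rw [labelInt_neg, labelInt_neg, h]))
      rwa [Pt.neg_neg, Pt.neg_neg] at this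
    have keymix : ∀ x y : Pt n, x.1 ≤ 0 → 0 ≤ y.1 → labelInt J x = labelInt J y →
        compSetoid J x y := by
      intro x y hx hy h
      let z : Pt n := ⟨0, by simp⟩
      have hz : labelInt J z = 0 := by simp [labelInt, z]
      have h1 := labelInt_of_nonpos J hx
      have h2 := labelInt_of_nonneg J hy
      exact (compSetoid J).trans (keyneg x z hx le_rfl (by omega)) (key z y le_rfl hy (by omega))
    rcases le_total 0 x.1 with hx | hx <;> rcases le_total 0 y.1 with hy | hy
    · exact key x y hx hy h
    · exact (compSetoid J).symm (keymix y x hy hx h.symm)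
    · exact keymix x y hx hy h
    · exact keyneg x y hx hy h
  · intro h
    change Relation.EqvGen (adjRel J) x y at h
    induction h with
    | rel x y h =>
      obtain ⟨j, hj, ⟨rfl, rfl⟩ | ⟨rfl, rfl⟩⟩ := h
      · exact labelInt_ptSucc hj
      · rw [labelInt_neg, labelInt_neg, labelInt_ptSucc hj]
    | refl x => rfl
    | symm x y _ ih => exact ih.symm
    | trans x y z _ _ ih1 ih2 => exact ih1.trans ih2

/-- The label as an element of `{-k, …, k}`, where `k = n - #J`. -/
def label {n k : ℕ} (J : Finset (Fin n)) (hJ : J.card + k = n) (x : Pt n) : Pt k :=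
  ⟨labelInt J x, by
    have h1 := gaps_top J
    have hx := abs_le.mp x.2
    have h2 := gaps_mono J (show x.1.natAbs ≤ n by omega)
    rw [abs_le]
    rcases le_total 0 x.1 with h | h
    · rw [labelInt_of_nonneg J h]; omega
    · rw [labelInt_of_nonpos J h]; omega⟩

theorem label_neg {n k : ℕ} (J : Finset (Fin n)) (hJ : J.card + k = n) (x : Pt n) :
    label J hJ (-x) = -label J hJ x := Subtype.ext (labelInt_neg J x)

theorem gaps_surj {n : ℕ} (J : Finset (Fin n)) (b : ℕ) (hb : b ≤ n) (c : ℕ) (hc : c ≤ gaps J b) :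
    ∃ a ≤ n, gaps J a = c := by
  induction b with
  | zero => exact ⟨0, hb, by rw [gaps_zero] at hc ⊢; omega⟩
  | succ b ih =>
    by_cases h : c = gaps J (b + 1)
    · exact ⟨b + 1, hb, h.symm⟩
    · refine ih (by omega) ?_
      have := gaps_succ J ⟨b, by omega⟩
      simp only at this
      split_ifs at this <;> omega

theorem label_surjective {n k : ℕ} (J : Finset (Fin n)) (hJ : J.card + k = n) :
    Function.Surjective (label J hJ) := by
  have key : ∀ c : Pt k, 0 ≤ c.1 → ∃ x, label J hJ x = c := by
    intro c hc
    have h1 := gaps_top J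
    have h2 := abs_le.mp c.2
    obtain ⟨a, ha, hac⟩ := gaps_surj J n le_rfl c.1.natAbs (by omega)
    refine ⟨⟨(a : ℤ), by rw [abs_of_nonneg (by positivity)]; omega⟩, Subtype.ext ?_⟩
    change labelInt J _ = _
    rw [labelInt_of_nonneg J (by simp)]
    simp only [Int.natAbs_natCast, hac]
    omega
  intro c
  rcases le_total 0 c.1 with h | h
  · exact key c h
  · obtain ⟨x, hx⟩ := key (-c) (by rw [Pt.coe_neg]; omega)
    exact ⟨-x, by rw [label_neg, hx, Pt.neg_neg]⟩

/-- The identification of the set of components with `{-k, …, k}`. -/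
def labelEquiv {n k : ℕ} (J : Finset (Fin n)) (hJ : J.card + k = n) :
    Quotient (compSetoid J) ≃ Pt k :=
  Equiv.ofBijective
    (Quotient.lift (label J hJ) fun x y h => Subtype.ext ((labelInt_eq_iff J x y).mpr h)) <| by
    constructor
    · intro a b
      induction a using Quotient.inductionOn with | _ x =>
      induction b using Quotient.inductionOn with | _ y =>
      intro h
      exact Quotient.sound ((labelInt_eq_iff J x y).mp (congrArg Subtype.val h))
    · intro c
      obtain ⟨x, hx⟩ := label_surjective J hJ c
      exact ⟨Quotient.mk _ x, hx⟩

theorem labelEquiv_mk {n k : ℕ} (J : Finset (Fin n)) (hJ : J.card + k = n) (x : Pt n) :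
    labelEquiv J hJ (Quotient.mk _ x) = label J hJ x := rfl

/-! ### Squashing -/

/-- `y` is a block permutation relative to `I` and `J`: each component of `J` is sent by an
order-preserving bijection onto a component of `I`. -/
structure IsBlock {n : ℕ} (I J : Finset (Fin n)) (y : W n) : Prop where
  image_eq : ∀ x, y.1 '' component J x = component I (y.1 x)
  strictMonoOn : ∀ x, StrictMonoOn y.1 (component J x)

theorem IsBlock.compSetoid_iff {n : ℕ} {I J : Finset (Fin n)} {y : W n} (h : IsBlock I J y)
    (a b : Pt n) : compSetoid J a b ↔ compSetoid I (y.1 a) (y.1 b) := by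
  have := h.image_eq b
  constructor
  · intro hab
    exact (this.subset ⟨a, hab, rfl⟩ : y.1 a ∈ component I (y.1 b))
  · intro hab
    obtain ⟨c, hc, hca⟩ := this.superset (show y.1 a ∈ component I (y.1 b) from hab)
    rwa [← y.1.injective hca]

/-- The permutation of `{-k, …, k}` induced by a block permutation on the sets of components. -/
def squashPerm {n k : ℕ} {I J : Finset (Fin n)} (hI : I.card + k = n) (hJ : J.card + k = n)
    {y : W n} (h : IsBlock I J y) : Equiv.Perm (Pt k) :=
  (labelEquiv J hJ).symm.trans
    ((Quotient.congr y.1 h.compSetoid_iff).trans (labelEquiv I hI))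

theorem squashPerm_label {n k : ℕ} {I J : Finset (Fin n)} (hI : I.card + k = n)
    (hJ : J.card + k = n) {y : W n} (h : IsBlock I J y) (x : Pt n) :
    squashPerm hI hJ h (label J hJ x) = label I hI (y.1 x) := by
  simp only [squashPerm, Equiv.trans_apply]
  rw [← labelEquiv_mk J hJ x, Equiv.symm_apply_apply]
  rfl

theorem squashPerm_mem {n k : ℕ} {I J : Finset (Fin n)} (hI : I.card + k = n)
    (hJ : J.card + k = n) {y : W n} (h : IsBlock I J y) : squashPerm hI hJ h ∈ weylGroup k := by
  intro c
  obtain ⟨x, rfl⟩ := label_surjective J hJ c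
  rw [← label_neg, squashPerm_label, squashPerm_label, y.2 x, label_neg]

open scoped Classical in
/-- The squashed permutation of a core `(I,J)`-coset with `#I = #J = n - k` (and `1` if this makes
no sense because the minimal element is not a block permutation). -/
def squash {n : ℕ} (k : ℕ) {I J : Finset (Fin n)} (p : Coset I J) : W k :=
  if h : I.card + k = n ∧ J.card + k = n ∧ IsBlock I J p.min then
    ⟨squashPerm h.1 h.2.1 h.2.2, squashPerm_mem h.1 h.2.1 h.2.2⟩
  else 1

/-- Squashing an atomic expression `[I_0, K_1, I_1, …, K_r, I_r]` to the word of the squashed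
permutations of the cosets expressed by `[I_{i-1}, K_i, I_i]`. -/
def squashExpr {n : ℕ} (k : ℕ) : List (Finset (Fin n)) → List (W k)
  | I :: K :: I' :: L => squash k (cosetOf I I' (longest K)) :: squashExpr k (I' :: L)
  | _ => []

/-- `ω` is a reduced expression of `w` as a product of simple reflections. -/
def IsOrdinaryReducedExpr {k : ℕ} (w : W k) (ω : List (W k)) : Prop :=
  (∀ s ∈ ω, s ∈ Set.range (simple : Fin k → W k)) ∧ ω.prod = w ∧ ω.length = len w

end TypeB

end

noncomputable section

namespace TypeB

/-! ### The length as a weighted number of inversions -/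

/-! Everything is reduced to signed permutations and their inversions. Bubble sort shows that the
Coxeter length is an inversion count (`four_mul_len`). Hence lengths add in `u * v` exactly when `u`
restores the order of no pair reversed by `v` (`len_mul_eq_iff`). Likewise `W_J` is the stabiliser
of the labels of `J`, and `w_J` is its unique element reversing every component.

If `y` is a block permutation, then `y⁻¹ W_I y = W_J`, so the double coset of `y` is `y W_J`, with
lengths adding in `y u`. Its minimal element is `y` and its maximal element is `y w_J`, and it is
core. Conversely, the two redundancy conditions of a core coset say that the minimal element carries
links of `J` to links of `I` and back, so it is a block permutation (`IsCore.isBlock`). Core cosets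
are thus the same as block permutations.

A block permutation keeps the order inside components, so its inversions live between components and
are visible after squashing. Therefore squashing is multiplicative, preserves and reflects
additivity of lengths (`len_mul_eq_iff_squash`), and has trivial kernel (`eq_one_of_squash`). This
gives compatibility with reduced compositions and injectivity.

An atomic coset with expression `[I, K, J]` has minimal element `y = w_K w_J` in `W_K` (`IsLink`).
Since `K` merges two neighbouring labels of `J` up to sign, or the labels `-1, 0, 1`, the squash
lies in a rank one parabolic subgroup and is a simple reflection. Every `t ∉ J` yields such a link,
so every simple reflection occurs, and composing links gives surjectivity onto `W_k`.

An atomic expression is a path of links. Its product is `y w_J`, with `y` the product of the links,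
and its length is `ℓ(w_J)` plus the sum of their lengths. So it is reduced exactly when lengths add
along the path, which by the squashing criterion means that the squashed word is reduced. The
starting set and the word determine the path, and every word can be followed. -/

instance (n : ℕ) : Fintype (Pt n) := Fintype.ofFinite _

theorem W.apply_neg {n : ℕ} (w : W n) (x : Pt n) : w.1 (-x) = -w.1 x := w.2 x

theorem W.mul_apply {n : ℕ} (u v : W n) (x : Pt n) : (u * v).1 x = u.1 (v.1 x) := rfl

theorem W.inv_apply_self {n : ℕ} (u : W n) (x : Pt n) : (u⁻¹).1 (u.1 x) = x := by
  rw [← W.mul_apply, inv_mul_cancel]; rfl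

theorem W.apply_inv_self {n : ℕ} (u : W n) (x : Pt n) : u.1 ((u⁻¹).1 x) = x := by
  rw [← W.mul_apply, mul_inv_cancel]; rfl

theorem W.ext' {n : ℕ} {u v : W n} (h : ∀ x, u.1 x = v.1 x) : u = v :=
  Subtype.ext (Equiv.ext h)

theorem Pt.lt_iff {n : ℕ} {a b : Pt n} : a < b ↔ a.1 < b.1 := Iff.rfl

theorem Pt.neg_lt_neg_iff {n : ℕ} {a b : Pt n} : -a < -b ↔ b < a := by
  rw [Pt.lt_iff, Pt.lt_iff, Pt.coe_neg, Pt.coe_neg]; omega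

theorem W.coe_apply_zero {n : ℕ} (w : W n) {x : Pt n} (hx : x.1 = 0) : (w.1 x).1 = 0 := by
  have e : -x = x := Subtype.ext (by rw [Pt.coe_neg]; omega)
  have h := congrArg Subtype.val (w.apply_neg x)
  rw [e, Pt.coe_neg] at h
  omega

theorem pt_val {n : ℕ} (i : Fin n) : (pt i).1 = (i : ℤ) := rfl

theorem ptSucc_val {n : ℕ} (i : Fin n) : (ptSucc i).1 = (i : ℤ) + 1 := rfl

theorem simple_apply_val {n : ℕ} (i : Fin n) (x : Pt n) :
    ((simple i).1 x).1 =
      if x.1 = i + 1 then (if (i : ℕ) = 0 then -1 else (i : ℤ))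
      else if x.1 = -(i + 1) then (if (i : ℕ) = 0 then 1 else -(i : ℤ))
      else if x.1 = i then (if (i : ℕ) = 0 then 0 else (i : ℤ) + 1)
      else if x.1 = -i then -(i + 1) else x.1 := by
  have hx : ∀ a : Pt n, x = a ↔ x.1 = a.1 := fun a => Subtype.ext_iff
  change (simplePerm i x).1 = _
  unfold simplePerm
  by_cases h : (i : ℕ) = 0
  · rw [if_pos h, Equiv.swap_apply_def]
    simp only [hx, Pt.coe_neg, ptSucc_val, h]
    split_ifs <;> simp_all [Pt.coe_neg, ptSucc_val]
  · rw [if_neg h, Equiv.Perm.mul_apply, Equiv.swap_apply_def, Equiv.swap_apply_def]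
    simp only [hx, Subtype.ext_iff, Pt.coe_neg, ptSucc_val, pt_val]
    split_ifs <;> simp_all [Pt.coe_neg, ptSucc_val, pt_val] <;> omega

/-- The weight of a pair of points, invariant under `W n`: pairs in one orbit under negation and
exchange have total weight `4`, except that `(0, b)` is subsumed under `(-b, b)`. -/
def wt {n : ℕ} (a b : Pt n) : ℕ :=
  if a = -b then 2 else if a = -a ∨ b = -b then 0 else 1

/-- Whether `w` changes the relative order of `a` and `b`. -/
def flip {n : ℕ} (w : W n) (a b : Pt n) : ℕ := if (a < b ↔ w.1 a < w.1 b) then 0 else 1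

/-- Four times the number of inversions of a signed permutation. -/
def invSum {n : ℕ} (w : W n) : ℕ := ∑ a, ∑ b, wt a b * flip w a b

/-- The weight of the pairs flipped by `v` and flipped back by `u`. -/
def cancelSum {n : ℕ} (u v : W n) : ℕ :=
  ∑ a, ∑ b, wt a b * flip v a b * flip u (v.1 a) (v.1 b)

theorem wt_apply {n : ℕ} (w : W n) (a b : Pt n) : wt (w.1 a) (w.1 b) = wt a b := by
  unfold wt
  simp only [← W.apply_neg, w.1.injective.eq_iff]

/-- A pair reversed by `v` and again by `u` counts twice on the right but is in order for `u * v`.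
-/
theorem flip_mul {n : ℕ} (u v : W n) (a b : Pt n) :
    flip (u * v) a b + 2 * (flip v a b * flip u (v.1 a) (v.1 b)) =
      flip v a b + flip u (v.1 a) (v.1 b) := by
  unfold flip
  simp only [W.mul_apply]
  by_cases h1 : a < b <;> by_cases h2 : v.1 a < v.1 b <;> by_cases h3 : u.1 (v.1 a) < u.1 (v.1 b) <;>
    simp [h1, h2, h3]

/-- Reindexing the inversions of `u` along `v` is harmless because the weight is invariant; then
`flip_mul` is summed over all pairs. -/
theorem invSum_mul {n : ℕ} (u v : W n) :
    invSum (u * v) + 2 * cancelSum u v = invSum u + invSum v := by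
  have h : invSum u = ∑ a, ∑ b, wt a b * flip u (v.1 a) (v.1 b) := by
    unfold invSum
    rw [← Equiv.sum_comp v.1]
    refine Finset.sum_congr rfl fun a _ => ?_
    rw [← Equiv.sum_comp v.1]
    simp only [wt_apply]
  rw [h]
  unfold invSum cancelSum
  simp only [Finset.mul_sum, ← Finset.sum_add_distrib]
  refine Finset.sum_congr rfl fun a _ => Finset.sum_congr rfl fun b _ => ?_
  have := flip_mul u v a b
  calc _ = wt a b * (flip (u * v) a b + 2 * (flip v a b * flip u (v.1 a) (v.1 b))) := by ring
    _ = _ := by rw [this]; ring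

theorem invSum_one (n : ℕ) : invSum (1 : W n) = 0 := by
  unfold invSum flip; simp

theorem flip_comm {n : ℕ} (w : W n) (a b : Pt n) : flip w b a = flip w a b := by
  rcases lt_trichotomy a b with h | h | h
  · have := w.1.injective.ne h.ne
    unfold flip
    rcases lt_or_gt_of_ne this with h' | h' <;> simp [h, h', h.not_gt, h'.not_gt]
  · rw [h]
  · have := w.1.injective.ne h.ne
    unfold flip
    rcases lt_or_gt_of_ne this with h' | h' <;> simp [h, h', h.not_gt, h'.not_gt]

theorem flip_neg {n : ℕ} (w : W n) (a b : Pt n) : flip w (-a) (-b) = flip w a b := by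
  rw [← flip_comm w a b]
  unfold flip
  simp only [W.apply_neg, Pt.neg_lt_neg_iff]

/-- The points exchanged by `s_i` are neighbours, so their position relative to any third point does
not change. -/
theorem flip_simple_eq_zero {n : ℕ} {i : Fin n} (hi : (i : ℕ) ≠ 0) {a b : Pt n}
    (h1 : ¬(a = ptSucc i ∧ b = pt i)) (h2 : ¬(a = pt i ∧ b = ptSucc i))
    (h3 : ¬(a = -ptSucc i ∧ b = -pt i)) (h4 : ¬(a = -pt i ∧ b = -ptSucc i)) :
    flip (simple i) a b = 0 := by
  have ha := simple_apply_val i a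
  have hb := simple_apply_val i b
  unfold flip
  rw [if_pos]
  simp only [Subtype.ext_iff, Pt.lt_iff, Pt.coe_neg, pt_val, ptSucc_val] at *
  have hm : 0 < (i : ℤ) := by omega
  simp only [hi, if_false] at ha hb
  generalize ((simple i).1 a).1 = a' at *
  generalize ((simple i).1 b).1 = b' at *
  generalize a.1 = x at *
  generalize b.1 = y at *
  generalize (i : ℤ) = m at *
  have ha : x = m + 1 ∧ a' = m ∨ x = -(m + 1) ∧ a' = -m ∨ x = m ∧ a' = m + 1 ∨
      x = -m ∧ a' = -(m + 1) ∨ (x ≠ m + 1 ∧ x ≠ -(m + 1) ∧ x ≠ m ∧ x ≠ -m) ∧ a' = x := by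
    clear hb h1 h2 h3 h4; split_ifs at ha <;> omega
  have hb : y = m + 1 ∧ b' = m ∨ y = -(m + 1) ∧ b' = -m ∨ y = m ∧ b' = m + 1 ∨
      y = -m ∧ b' = -(m + 1) ∨ (y ≠ m + 1 ∧ y ≠ -(m + 1) ∧ y ≠ m ∧ y ≠ -m) ∧ b' = y := by
    clear ha h1 h2 h3 h4; split_ifs at hb <;> omega
  rcases ha with ⟨rfl, rfl⟩ | ⟨rfl, rfl⟩ | ⟨rfl, rfl⟩ | ⟨rfl, rfl⟩ | ⟨ha, rfl⟩ <;>
    rcases hb with ⟨rfl, rfl⟩ | ⟨rfl, rfl⟩ | ⟨rfl, rfl⟩ | ⟨rfl, rfl⟩ | ⟨hb, rfl⟩ <;>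
    constructor <;> intro _ <;> omega

/-- The reflection `s_0` also reverses `(0, 1)` and `(-1, 0)`; these have weight zero, which leaves
only `(-1, 1)`. -/
theorem wt_mul_flip_simple_zero {n : ℕ} {i : Fin n} (hi : (i : ℕ) = 0) (a b : Pt n) :
    wt a b * flip (simple i) a b =
      (if a = ptSucc i then (if b = -ptSucc i then 2 else 0) else 0) +
      (if a = -ptSucc i then (if b = ptSucc i then 2 else 0) else 0) := by
  have ha := simple_apply_val i a
  have hb := simple_apply_val i b
  unfold wt flip
  simp only [Subtype.ext_iff, Pt.lt_iff, Pt.coe_neg, ptSucc_val]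
  generalize ((simple i).1 a).1 = a' at *
  generalize ((simple i).1 b).1 = b' at *
  generalize a.1 = x at *
  generalize b.1 = y at *
  have ha : (x = 1 ∨ x = -1) ∧ a' = -x ∨ (x ≠ 1 ∧ x ≠ -1) ∧ a' = x := by
    clear hb; simp only [hi] at ha; split_ifs at ha <;> omega
  have hb : (y = 1 ∨ y = -1) ∧ b' = -y ∨ (y ≠ 1 ∧ y ≠ -1) ∧ b' = y := by
    clear ha; simp only [hi] at hb; split_ifs at hb <;> omega
  simp only [hi]
  rcases ha with ⟨rfl | rfl, rfl⟩ | ⟨ha, rfl⟩ <;> rcases hb with ⟨rfl | rfl, rfl⟩ | ⟨hb, rfl⟩ <;>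
    split_ifs <;> omega

theorem wt_mul_flip_simple {n : ℕ} (i : Fin n) (a b : Pt n) :
    wt a b * flip (simple i) a b =
      if (i : ℕ) = 0 then
        (if a = ptSucc i then (if b = -ptSucc i then 2 else 0) else 0) +
        (if a = -ptSucc i then (if b = ptSucc i then 2 else 0) else 0)
      else
        (if a = ptSucc i then (if b = pt i then 1 else 0) else 0) +
        (if a = pt i then (if b = ptSucc i then 1 else 0) else 0) +
        (if a = -ptSucc i then (if b = -pt i then 1 else 0) else 0) +
        (if a = -pt i then (if b = -ptSucc i then 1 else 0) else 0) := by
  by_cases hi : (i : ℕ) = 0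
  · rw [if_pos hi, wt_mul_flip_simple_zero hi]
  rw [if_neg hi]
  have f1 : flip (simple i) (pt i) (ptSucc i) = 1 := by
    unfold flip
    rw [if_neg]
    rw [Pt.lt_iff, Pt.lt_iff, simple_apply_val, simple_apply_val, pt_val, ptSucc_val]
    split_ifs <;> omega
  have w1 : wt (pt i) (ptSucc i) = 1 ∧ wt (ptSucc i) (pt i) = 1 ∧
      wt (-pt i) (-ptSucc i) = 1 ∧ wt (-ptSucc i) (-pt i) = 1 := by
    simp only [wt, Subtype.ext_iff, Pt.coe_neg, pt_val, ptSucc_val]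
    refine ⟨?_, ?_, ?_, ?_⟩ <;> split_ifs <;> omega
  have ne : (∀ x : Pt n, x = pt i → x ≠ ptSucc i ∧ x ≠ -pt i ∧ x ≠ -ptSucc i) ∧
      (∀ x : Pt n, x = ptSucc i → x ≠ pt i ∧ x ≠ -pt i ∧ x ≠ -ptSucc i) ∧
      (∀ x : Pt n, x = -pt i → x ≠ pt i ∧ x ≠ ptSucc i ∧ x ≠ -ptSucc i) ∧
      (∀ x : Pt n, x = -ptSucc i → x ≠ pt i ∧ x ≠ ptSucc i ∧ x ≠ -pt i) := by
    simp only [ne_eq, Subtype.ext_iff, Pt.coe_neg, pt_val, ptSucc_val]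
    refine ⟨?_, ?_, ?_, ?_⟩ <;> intro x hx <;> omega
  obtain ⟨n1, n2, n3, n4⟩ := ne
  by_cases h1 : a = ptSucc i ∧ b = pt i
  · obtain ⟨rfl, rfl⟩ := h1
    rw [flip_comm, f1, w1.2.1]
    simp [n2 _ rfl]
  by_cases h2 : a = pt i ∧ b = ptSucc i
  · obtain ⟨rfl, rfl⟩ := h2
    rw [f1, w1.1]
    simp [n1 _ rfl]
  by_cases h3 : a = -ptSucc i ∧ b = -pt i
  · obtain ⟨rfl, rfl⟩ := h3
    rw [flip_neg, flip_comm, f1, w1.2.2.2]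
    simp [n4 _ rfl]
  by_cases h4 : a = -pt i ∧ b = -ptSucc i
  · obtain ⟨rfl, rfl⟩ := h4
    rw [flip_neg, f1, w1.2.2.1]
    simp [n3 _ rfl]
  rw [flip_simple_eq_zero hi h1 h2 h3 h4]
  simp only [← ite_and, if_neg h1, if_neg h2, if_neg h3, if_neg h4, mul_zero, add_zero]

theorem invSum_simple {n : ℕ} (i : Fin n) : invSum (simple i) = 4 := by
  unfold invSum
  simp only [wt_mul_flip_simple]
  split_ifs <;> simp [Finset.sum_add_distrib]

/-- The weighted inversions of `s_i` form one orbit under exchange and negation, of total weight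
`4`, and `w` reverses all of them or none. -/
theorem cancelSum_simple {n : ℕ} (w : W n) (i : Fin n) :
    cancelSum w (simple i) = 4 * flip w (pt i) (ptSucc i) := by
  rw [← invSum_simple i]
  unfold cancelSum invSum
  simp only [Finset.sum_mul]
  refine Finset.sum_congr rfl fun a _ => Finset.sum_congr rfl fun b _ => ?_
  have e : ∀ x y : Pt n, (simple i).1 x = y ↔ ((simple i).1 x).1 = y.1 := fun _ _ => Subtype.ext_iff
  -- As `w` is odd and fixes `0`, it reverses `(-1, 1)` exactly if it reverses `(0, 1)`.
  have h0 : (i : ℕ) = 0 → flip w (-ptSucc i) (ptSucc i) = flip w (pt i) (ptSucc i) := by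
    intro hi
    have h1 := W.coe_apply_zero w (x := pt i) (by rw [pt_val]; omega)
    unfold flip
    simp only [Pt.lt_iff, W.apply_neg, Pt.coe_neg, h1, ptSucc_val, pt_val]
    congr 1
    simp only [eq_iff_iff]
    constructor <;> intro h <;> omega
  have s1 : (simple i).1 (ptSucc i) = if (i : ℕ) = 0 then -ptSucc i else pt i := by
    rw [e, simple_apply_val]
    split_ifs <;> simp_all [Pt.coe_neg, pt_val, ptSucc_val]
  have s2 : (i : ℕ) ≠ 0 → (simple i).1 (pt i) = ptSucc i := by
    intro hi
    rw [e, simple_apply_val, pt_val, ptSucc_val]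
    split_ifs <;> omega
  rw [wt_mul_flip_simple]
  by_cases hi : (i : ℕ) = 0
  · rw [if_pos hi] at s1
    simp only [hi, if_true]
    by_cases h1 : a = ptSucc i ∧ b = -ptSucc i
    · obtain ⟨rfl, rfl⟩ := h1
      rw [W.apply_neg, s1, Pt.neg_neg, h0 hi]
    by_cases h2 : a = -ptSucc i ∧ b = ptSucc i
    · obtain ⟨rfl, rfl⟩ := h2
      rw [W.apply_neg, s1, Pt.neg_neg, flip_comm, h0 hi]
    simp only [← ite_and, if_neg h1, if_neg h2, add_zero, zero_mul]
  · rw [if_neg hi] at s1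
    have s2 := s2 hi
    simp only [hi, if_false]
    by_cases h1 : a = ptSucc i ∧ b = pt i
    · obtain ⟨rfl, rfl⟩ := h1
      rw [s1, s2]
    by_cases h2 : a = pt i ∧ b = ptSucc i
    · obtain ⟨rfl, rfl⟩ := h2
      rw [s1, s2, flip_comm]
    by_cases h3 : a = -ptSucc i ∧ b = -pt i
    · obtain ⟨rfl, rfl⟩ := h3
      rw [W.apply_neg, W.apply_neg, flip_neg, s1, s2]
    by_cases h4 : a = -pt i ∧ b = -ptSucc i
    · obtain ⟨rfl, rfl⟩ := h4
      rw [W.apply_neg, W.apply_neg, flip_neg, s1, s2, flip_comm]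
    simp only [← ite_and, if_neg h1, if_neg h2, if_neg h3, if_neg h4, add_zero, zero_mul]

theorem invSum_mul_simple {n : ℕ} (w : W n) (i : Fin n) :
    invSum (w * simple i) + 8 * flip w (pt i) (ptSucc i) = invSum w + 4 := by
  have := invSum_mul w (simple i)
  rw [cancelSum_simple, invSum_simple] at this
  omega

theorem pt_lt_ptSucc {n : ℕ} (i : Fin n) : pt i < ptSucc i := by
  rw [Pt.lt_iff, pt_val, ptSucc_val]; omega

theorem flip_of_descent {n : ℕ} {w : W n} {a b : Pt n} (hab : a < b) (h : w.1 b < w.1 a) :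
    flip w a b = 1 := by
  unfold flip; simp [hab, h.not_gt]

theorem flip_of_ascent {n : ℕ} {w : W n} {a b : Pt n} (hab : a < b) (h : w.1 a < w.1 b) :
    flip w a b = 0 := by
  unfold flip; simp [hab, h]

/-! ### Adjacent points and components -/

theorem mem_of_labelInt_eq {n : ℕ} {J : Finset (Fin n)} {j : Fin n}
    (h : labelInt J (pt j) = labelInt J (ptSucc j)) : j ∈ J := by
  rw [labelInt_of_nonneg J (x := pt j) (by rw [pt_val]; omega),
    labelInt_of_nonneg J (x := ptSucc j) (by rw [ptSucc_val]; omega)] at h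
  have h1 : (pt j).1.natAbs = j := by simp [pt]
  have h2 : (ptSucc j).1.natAbs = j + 1 := by simp only [ptSucc]; omega
  rw [h1, h2, gaps_succ] at h
  by_contra hj
  rw [if_neg hj] at h
  omega

theorem exists_link {n : ℕ} {a b : Pt n} (hab : b.1 = a.1 + 1) :
    ∃ j : Fin n, (a = pt j ∧ b = ptSucc j) ∨ (a = -ptSucc j ∧ b = -pt j) := by
  have ha := abs_le.mp a.2
  have hb := abs_le.mp b.2
  rcases le_or_gt 0 a.1 with h | h
  · refine ⟨⟨a.1.natAbs, by omega⟩, Or.inl ⟨Subtype.ext ?_, Subtype.ext ?_⟩⟩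
    · rw [pt_val]; simp only; omega
    · rw [ptSucc_val]; simp only; omega
  · refine ⟨⟨b.1.natAbs, by omega⟩, Or.inr ⟨Subtype.ext ?_, Subtype.ext ?_⟩⟩
    · rw [Pt.coe_neg, ptSucc_val]; simp only; omega
    · rw [Pt.coe_neg, pt_val]; simp only; omega

theorem exists_link_mem {n : ℕ} {J : Finset (Fin n)} {a b : Pt n} (hab : b.1 = a.1 + 1)
    (h : labelInt J a = labelInt J b) :
    ∃ j ∈ J, (a = pt j ∧ b = ptSucc j) ∨ (a = -ptSucc j ∧ b = -pt j) := by
  obtain ⟨j, hj⟩ := exists_link hab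
  refine ⟨j, mem_of_labelInt_eq ?_, hj⟩
  rcases hj with ⟨rfl, rfl⟩ | ⟨rfl, rfl⟩
  · exact h
  · rw [labelInt_neg, labelInt_neg] at h; omega

/-- A transitive relation that holds between adjacent points of the same component holds
between any two points of the same component. -/
theorem rel_of_adjacent {n : ℕ} (J : Finset (Fin n)) (r : Pt n → Pt n → Prop)
    (htrans : ∀ a b c, r a b → r b c → r a c)
    (h : ∀ a b : Pt n, b.1 = a.1 + 1 → labelInt J a = labelInt J b → r a b) :
    ∀ x y, x < y → labelInt J x = labelInt J y → r x y := by
  have key : ∀ d : ℕ, ∀ x y : Pt n, y.1 = x.1 + 1 + d → labelInt J x = labelInt J y → r x y := by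
    intro d
    induction d with
    | zero => intro x y hxy; exact h x y (by simpa using hxy)
    | succ d ih =>
      intro x y hxy hl
      have hx := abs_le.mp x.2
      have hy := abs_le.mp y.2
      let z : Pt n := ⟨x.1 + 1, abs_le.mpr ⟨by omega, by push_cast at hxy; omega⟩⟩
      have h1 := labelInt_mono J (x := x) (y := z) (show x.1 ≤ x.1 + 1 by omega)
      have h2 := labelInt_mono J (x := z) (y := y)
        (show x.1 + 1 ≤ y.1 by push_cast at hxy; omega)
      refine htrans _ z _ (h _ _ rfl (by omega)) (ih z y ?_ (by omega))
      change y.1 = x.1 + 1 + 1 + d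
      push_cast at hxy; omega
  intro x y hxy hl
  have hxy : x.1 < y.1 := hxy
  exact key (y.1 - x.1 - 1).toNat x y (by omega) hl

theorem lt_of_ascents {n : ℕ} {J : Finset (Fin n)} {w : W n}
    (h : ∀ j ∈ J, w.1 (pt j) < w.1 (ptSucc j)) {x y : Pt n} (hxy : x < y)
    (hl : labelInt J x = labelInt J y) : w.1 x < w.1 y := by
  refine rel_of_adjacent J (fun a b => w.1 a < w.1 b) (fun _ _ _ => lt_trans) ?_ x y hxy hl
  intro a b hab hl
  obtain ⟨j, hj, ⟨rfl, rfl⟩ | ⟨rfl, rfl⟩⟩ := exists_link_mem hab hl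
  · exact h j hj
  · rw [W.apply_neg, W.apply_neg, Pt.neg_lt_neg_iff]; exact h j hj

theorem lt_of_descents {n : ℕ} {J : Finset (Fin n)} {w : W n}
    (h : ∀ j ∈ J, w.1 (ptSucc j) < w.1 (pt j)) {x y : Pt n} (hxy : x < y)
    (hl : labelInt J x = labelInt J y) : w.1 y < w.1 x := by
  refine rel_of_adjacent J (fun a b => w.1 b < w.1 a) (fun _ _ _ h1 h2 => lt_trans h2 h1) ?_
    x y hxy hl
  intro a b hab hl
  obtain ⟨j, hj, ⟨rfl, rfl⟩ | ⟨rfl, rfl⟩⟩ := exists_link_mem hab hl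
  · exact h j hj
  · rw [W.apply_neg, W.apply_neg, Pt.neg_lt_neg_iff]; exact h j hj

/-- A finite linear order has no order automorphism besides the identity. -/
theorem eq_one_of_strictMono {n : ℕ} {w : W n} (h : StrictMono w.1) : w = 1 := by
  let e : Pt n ≃o Pt n := StrictMono.orderIsoOfSurjective w.1 h w.1.surjective
  have he : e = OrderIso.refl _ := Subsingleton.elim _ _
  refine W.ext' fun x => ?_
  exact congrArg (fun f : Pt n ≃o Pt n => f x) he

theorem labelInt_univ {n : ℕ} (x : Pt n) : labelInt Finset.univ x = 0 := by
  have : ∀ a, gaps (Finset.univ : Finset (Fin n)) a = 0 := fun a => by simp [gaps]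
  simp [labelInt, this]

theorem eq_one_of_ascents {n : ℕ} {w : W n} (h : ∀ j : Fin n, w.1 (pt j) < w.1 (ptSucc j)) :
    w = 1 :=
  eq_one_of_strictMono fun x y hxy =>
    lt_of_ascents (J := Finset.univ) (fun j _ => h j) hxy (by rw [labelInt_univ, labelInt_univ])

theorem exists_descent {n : ℕ} {w : W n} (h : w ≠ 1) :
    ∃ j : Fin n, w.1 (ptSucc j) < w.1 (pt j) := by
  by_contra! hn
  exact h (eq_one_of_ascents fun j =>
    lt_of_le_of_ne (hn j) (w.1.injective.ne (pt_lt_ptSucc j).ne))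

/-! ### Coxeter length equals the number of inversions -/

theorem simple_mul_self {n : ℕ} (i : Fin n) : simple i * simple i = 1 := by
  refine W.ext' fun x => Subtype.ext ?_
  rw [W.mul_apply, simple_apply_val, simple_apply_val]
  change _ = x.1
  split_ifs <;> omega

theorem simple_inv {n : ℕ} (i : Fin n) : (simple i)⁻¹ = simple i :=
  inv_eq_of_mul_eq_one_left (simple_mul_self i)

theorem invSum_prod_le {n : ℕ} (ω : List (Fin n)) :
    invSum (ω.map simple).prod ≤ 4 * ω.length := by
  induction ω with
  | nil => simp [invSum_one]
  | cons i ω ih =>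
    have := invSum_mul (simple i) (ω.map simple).prod
    rw [invSum_simple] at this
    rw [List.map_cons, List.prod_cons, List.length_cons]
    omega

/-- Bubble sort: a non-trivial `w` has a descent, and multiplying by that simple reflection lowers
`invSum` by `4`. -/
theorem exists_word {n : ℕ} (w : W n) :
    ∃ ω : List (Fin n), (ω.map simple).prod = w ∧ 4 * ω.length = invSum w := by
  induction hN : invSum w using Nat.strong_induction_on generalizing w with
  | _ N ih =>
    subst hN
    by_cases h : w = 1
    · exact ⟨[], by simp [h, invSum_one]⟩
    · obtain ⟨j, hj⟩ := exists_descent h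
      have h1 := invSum_mul_simple w j
      rw [flip_of_descent (pt_lt_ptSucc j) hj] at h1
      obtain ⟨ω, h2, h3⟩ := ih _ (by omega) (w * simple j) rfl
      refine ⟨ω ++ [j], ?_, ?_⟩
      · simp [h2, mul_assoc, simple_mul_self]
      · simp; omega

/-- Each letter of a word adds at most `4` to `invSum`, and bubble sort attains this bound. -/
theorem four_mul_len {n : ℕ} (w : W n) : 4 * len w = invSum w := by
  obtain ⟨ω, h1, h2⟩ := exists_word w
  have hne : {d | ∃ ω : List (Fin n), ω.length = d ∧ (ω.map simple).prod = w}.Nonempty :=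
    ⟨_, ω, rfl, h1⟩
  have h3 : len w ≤ ω.length := Nat.sInf_le ⟨ω, rfl, h1⟩
  obtain ⟨ω', h4, h5⟩ := Nat.sInf_mem hne
  have h6 := invSum_prod_le ω'
  rw [h5, h4] at h6
  change _ ≤ 4 * len w at h6
  omega

theorem len_one (n : ℕ) : len (1 : W n) = 0 := by
  have := four_mul_len (1 : W n)
  rw [invSum_one] at this
  omega

theorem eq_one_of_len {n : ℕ} {w : W n} (h : len w = 0) : w = 1 := by
  obtain ⟨ω, h1, h2⟩ := exists_word w
  rw [← four_mul_len, h] at h2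
  have h3 : ω = [] := List.length_eq_zero_iff.mp (by omega)
  rw [h3] at h1
  simpa using h1.symm

theorem len_mul_le {n : ℕ} (u v : W n) : len (u * v) ≤ len u + len v := by
  have := invSum_mul u v
  rw [← four_mul_len, ← four_mul_len, ← four_mul_len] at this
  omega

theorem len_simple {n : ℕ} (i : Fin n) : len (simple i) = 1 := by
  have := four_mul_len (simple i)
  rw [invSum_simple] at this
  omega

theorem len_mul_simple_of_descent {n : ℕ} {w : W n} {i : Fin n}
    (h : w.1 (ptSucc i) < w.1 (pt i)) : len (w * simple i) + 1 = len w := by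
  have := invSum_mul_simple w i
  rw [flip_of_descent (pt_lt_ptSucc i) h, ← four_mul_len, ← four_mul_len] at this
  omega

theorem len_mul_simple_of_ascent {n : ℕ} {w : W n} {i : Fin n}
    (h : w.1 (pt i) < w.1 (ptSucc i)) : len (w * simple i) = len w + 1 := by
  have := invSum_mul_simple w i
  rw [flip_of_ascent (pt_lt_ptSucc i) h, ← four_mul_len, ← four_mul_len] at this
  omega

theorem apply_pt_ne {n : ℕ} (w : W n) (i : Fin n) : w.1 (pt i) ≠ w.1 (ptSucc i) :=
  w.1.injective.ne (pt_lt_ptSucc i).ne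

/-- Lengths add in a product if and only if no inversion is undone. -/
theorem len_mul_eq_iff {n : ℕ} (u v : W n) : len (u * v) = len u + len v ↔
    ∀ a b, a < b → v.1 b < v.1 a → u.1 (v.1 b) < u.1 (v.1 a) := by
  have hmul := invSum_mul u v
  rw [← four_mul_len, ← four_mul_len, ← four_mul_len] at hmul
  have h0 : len (u * v) = len u + len v ↔ cancelSum u v = 0 := by omega
  rw [h0]
  unfold cancelSum
  simp only [Finset.sum_eq_zero_iff, Finset.mem_univ, true_implies]
  constructor
  · intro h
    have key : ∀ a b, a < b → v.1 b < v.1 a → wt a b ≠ 0 → u.1 (v.1 b) < u.1 (v.1 a) := by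
      intro a b hab hv hw
      by_contra hu
      have hu : u.1 (v.1 a) < u.1 (v.1 b) :=
        lt_of_le_of_ne (not_lt.mp hu) (u.1.injective.ne hv.ne')
      have := h a b
      rw [flip_of_descent hab hv, flip_comm, flip_of_descent hv hu] at this
      simp at this
      exact hw this
    have key0 : ∀ b, (-b : Pt n) < b → v.1 b < v.1 (-b) → u.1 (v.1 b) < u.1 (v.1 (-b)) :=
      fun b h1 h2 => key _ _ h1 h2 (by simp [wt])
    intro a b hab hv
    -- Pairs containing `0` have weight zero and are recovered from `(-b, b)`: since `u` and `v` are
    -- odd and fix `0`, both pairs are reversed together.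
    by_cases ha : a.1 = 0
    · have e1 := v.coe_apply_zero ha
      have e2 := u.coe_apply_zero e1
      have := key0 b
      simp only [W.apply_neg, Pt.lt_iff, Pt.coe_neg] at *
      omega
    by_cases hb : b.1 = 0
    · have e1 := v.coe_apply_zero hb
      have e2 := u.coe_apply_zero e1
      have := key0 (-a)
      simp only [W.apply_neg, Pt.lt_iff, Pt.coe_neg, Pt.neg_neg] at *
      omega
    refine key a b hab hv ?_
    unfold wt
    have h1 : a ≠ -a := fun e => ha (by have := congrArg Subtype.val e; rw [Pt.coe_neg] at this; omega)
    have h2 : b ≠ -b := fun e => hb (by have := congrArg Subtype.val e; rw [Pt.coe_neg] at this; omega)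
    simp [h1, h2]
    split_ifs <;> simp
  · intro h
    have key : ∀ a b, a < b → wt a b * flip v a b * flip u (v.1 a) (v.1 b) = 0 := by
      intro a b hab
      rcases lt_or_gt_of_ne (v.1.injective.ne hab.ne) with hv | hv
      · rw [flip_of_ascent hab hv]; simp
      · rw [flip_comm u, flip_of_ascent hv (h a b hab hv)]; simp
    intro a b
    rcases lt_trichotomy a b with hab | rfl | hab
    · exact key a b hab
    · simp [flip]
    · have h1 := key b a hab
      rw [flip_comm v a b, flip_comm u (v.1 a)] at h1
      rcases mul_eq_zero.mp h1 with h1 | h1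
      · rcases mul_eq_zero.mp h1 with h1 | h1
        · have : wt a b = wt b a := by
            have e : a = -b ↔ b = -a :=
              ⟨fun h => by rw [h, Pt.neg_neg], fun h => by rw [h, Pt.neg_neg]⟩
            unfold wt
            simp only [e, or_comm]
          rw [this, h1]; simp
        · rw [h1]; simp
      · rw [h1]; simp

/-! ### Parabolic subgroups and their longest elements -/

theorem simple_apply_cases {n : ℕ} (j : Fin n) (x : Pt n) :
    (simple j).1 x = x ∨ (x = ptSucc j ∧ ((simple j).1 x = pt j ∨ (simple j).1 x = -ptSucc j ∧ (j : ℕ) = 0)) ∨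
      (x = pt j ∧ (simple j).1 x = ptSucc j) ∨
      (x = -ptSucc j ∧ ((simple j).1 x = -pt j ∨ (simple j).1 x = ptSucc j ∧ (j : ℕ) = 0)) ∨
      (x = -pt j ∧ (simple j).1 x = -ptSucc j) := by
  have := simple_apply_val j x
  simp only [Subtype.ext_iff, Pt.coe_neg, pt_val, ptSucc_val]
  split_ifs at this <;> omega

theorem labelInt_pt_eq_zero {n : ℕ} {J : Finset (Fin n)} {j : Fin n} (hj : (j : ℕ) = 0) :
    labelInt J (pt j) = 0 := by
  simp [labelInt, pt_val, hj]

theorem labelInt_simple {n : ℕ} {J : Finset (Fin n)} {j : Fin n} (hj : j ∈ J) (x : Pt n) :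
    labelInt J ((simple j).1 x) = labelInt J x := by
  have h := labelInt_ptSucc hj
  rcases simple_apply_cases j x with h1 | ⟨h1, h2 | ⟨h2, h3⟩⟩ | ⟨h1, h2⟩ | ⟨h1, h2 | ⟨h2, h3⟩⟩ | ⟨h1, h2⟩
  · rw [h1]
  · rw [h2, h1, h]
  · have := labelInt_pt_eq_zero (J := J) h3
    rw [h2, h1, labelInt_neg]; omega
  · rw [h2, h1, h]
  · rw [h2, h1, labelInt_neg, labelInt_neg, h]
  · have := labelInt_pt_eq_zero (J := J) h3
    rw [h2, h1, labelInt_neg]; omega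
  · rw [h2, h1, labelInt_neg, labelInt_neg, h]

theorem lt_of_labelInt_lt {n : ℕ} {J : Finset (Fin n)} {x y : Pt n}
    (h : labelInt J x < labelInt J y) : x < y := by
  by_contra hn
  exact absurd (labelInt_mono J (not_lt.mp hn)) (by omega)

/-- The parabolic subgroup `W_J` consists of the elements that preserve each component of `J`. -/
theorem mem_parabolic_iff {n : ℕ} {J : Finset (Fin n)} {w : W n} :
    w ∈ parabolic J ↔ ∀ x, labelInt J (w.1 x) = labelInt J x := by
  constructor
  · intro h
    induction h using Subgroup.closure_induction with
    | mem w hw =>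
      obtain ⟨j, hj, rfl⟩ := hw
      exact labelInt_simple hj
    | one => intro x; rfl
    | mul u v _ _ hu hv => intro x; rw [W.mul_apply, hu, hv]
    | inv u _ hu =>
      intro x
      rw [← hu, W.apply_inv_self]
  · intro h
    induction hN : len w using Nat.strong_induction_on generalizing w with
    | _ N ih =>
      subst hN
      by_cases h1 : w = 1
      · rw [h1]; exact one_mem _
      · obtain ⟨j, hj⟩ := exists_descent h1
        -- Labels are monotone and preserved by `w`, so a descent of `w` can only occur between two
        -- points of one component.
        have hJ : j ∈ J := by
          apply mem_of_labelInt_eq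
          have h2 := labelInt_mono J hj.le
          have h3 := labelInt_mono J (pt_lt_ptSucc j).le
          rw [h, h] at h2
          omega
        have h2 := len_mul_simple_of_descent hj
        have h3 := ih _ (by omega) (w := w * simple j)
          (fun x => by rw [W.mul_apply, h, labelInt_simple hJ]) rfl
        have h4 : simple j ∈ parabolic J := Subgroup.subset_closure ⟨j, hJ, rfl⟩
        have h5 := mul_mem h3 h4
        rwa [mul_assoc, simple_mul_self, mul_one] at h5

theorem simple_mem_parabolic {n : ℕ} {J : Finset (Fin n)} {j : Fin n} (hj : j ∈ J) :
    simple j ∈ parabolic J := Subgroup.subset_closure ⟨j, hj, rfl⟩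

/-- Points with different labels keep their order because labels are preserved, so such a `w` is
increasing everywhere. -/
theorem eq_one_of_mem_parabolic {n : ℕ} {J : Finset (Fin n)} {w : W n} (hw : w ∈ parabolic J)
    (h : ∀ x y, x < y → labelInt J x = labelInt J y → w.1 x < w.1 y) : w = 1 := by
  rw [mem_parabolic_iff] at hw
  refine eq_one_of_strictMono fun x y hxy => ?_
  rcases (labelInt_mono J hxy.le).lt_or_eq with h1 | h1
  · apply lt_of_labelInt_lt (J := J)
    rwa [hw, hw]
  · exact h x y hxy h1

theorem maxElt_spec {n : ℕ} {A : Set (W n)} (h : A.Nonempty) :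
    maxElt A ∈ A ∧ ∀ z ∈ A, len z ≤ len (maxElt A) := by
  unfold maxElt
  rw [dif_pos h]
  exact (Set.exists_max_image A len A.toFinite h).choose_spec

theorem minElt_spec {n : ℕ} {A : Set (W n)} (h : A.Nonempty) :
    minElt A ∈ A ∧ ∀ z ∈ A, len (minElt A) ≤ len z := by
  unfold minElt
  rw [dif_pos h]
  exact (Set.exists_min_image A len A.toFinite h).choose_spec

/-- At an ascent `j ∈ J`, the product `u * simple j` would be a longer element of `W_J`. -/
theorem antitone_of_maximal {n : ℕ} {J : Finset (Fin n)} {u : W n} (hu : u ∈ parabolic J)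
    (h : ∀ z ∈ parabolic J, len z ≤ len u) {x y : Pt n} (hxy : x < y)
    (hl : labelInt J x = labelInt J y) : u.1 y < u.1 x := by
  refine lt_of_descents (fun j hj => ?_) hxy hl
  by_contra hn
  have h1 := len_mul_simple_of_ascent (lt_of_le_of_ne (not_lt.mp hn) (apply_pt_ne u j))
  have h2 := h _ (mul_mem hu (simple_mem_parabolic hj))
  omega

/-- Two reversals of each component cancel, so `u⁻¹ * v` is increasing on components and hence
trivial. -/
theorem eq_of_antitone {n : ℕ} {J : Finset (Fin n)} {u v : W n} (hu : u ∈ parabolic J)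
    (hv : v ∈ parabolic J)
    (hu' : ∀ x y, x < y → labelInt J x = labelInt J y → u.1 y < u.1 x)
    (hv' : ∀ x y, x < y → labelInt J x = labelInt J y → v.1 y < v.1 x) : u = v := by
  have h : u⁻¹ * v = 1 := by
    refine eq_one_of_mem_parabolic (mul_mem (inv_mem hu) hv) fun x y hxy hl => ?_
    by_contra hn
    have h1 := lt_of_le_of_ne (not_lt.mp hn) ((u⁻¹ * v).1.injective.ne hxy.ne')
    have h2 := mem_parabolic_iff.mp (mul_mem (inv_mem hu) hv)
    have h3 := hu' _ _ h1 (by rw [h2, h2, hl])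
    rw [W.mul_apply, W.mul_apply, W.apply_inv_self, W.apply_inv_self] at h3
    exact absurd h3 (hv' x y hxy hl).not_gt
  rw [← mul_one u, ← h, mul_inv_cancel_left]

theorem longest_spec {n : ℕ} (J : Finset (Fin n)) :
    longest J ∈ parabolic J ∧ ∀ z ∈ parabolic J, len z ≤ len (longest J) :=
  maxElt_spec (A := (parabolic J : Set (W n))) ⟨1, one_mem _⟩

theorem labelInt_longest {n : ℕ} (J : Finset (Fin n)) (x : Pt n) :
    labelInt J ((longest J).1 x) = labelInt J x := mem_parabolic_iff.mp (longest_spec J).1 x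

theorem longest_antitone {n : ℕ} {J : Finset (Fin n)} {x y : Pt n} (hxy : x < y)
    (hl : labelInt J x = labelInt J y) : (longest J).1 y < (longest J).1 x :=
  antitone_of_maximal (longest_spec J).1 (longest_spec J).2 hxy hl

theorem eq_longest {n : ℕ} {J : Finset (Fin n)} {u : W n} (hu : u ∈ parabolic J)
    (h : ∀ x y, x < y → labelInt J x = labelInt J y → u.1 y < u.1 x) : u = longest J :=
  eq_of_antitone hu (longest_spec J).1 h fun _ _ => longest_antitone

theorem longest_mul_self {n : ℕ} (J : Finset (Fin n)) : longest J * longest J = 1 := by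
  refine eq_one_of_mem_parabolic (mul_mem (longest_spec J).1 (longest_spec J).1)
    fun x y hxy hl => ?_
  exact longest_antitone (longest_antitone hxy hl) (by rw [labelInt_longest, labelInt_longest, hl])

theorem longest_inv {n : ℕ} (J : Finset (Fin n)) : (longest J)⁻¹ = longest J :=
  inv_eq_of_mul_eq_one_left (longest_mul_self J)

/-- The descents of `w_J` recover `J`; this lets sets be identified by comparing longest elements.
-/
theorem mem_iff_longest {n : ℕ} (J : Finset (Fin n)) (j : Fin n) :
    j ∈ J ↔ (longest J).1 (ptSucc j) < (longest J).1 (pt j) := by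
  constructor
  · intro h
    exact longest_antitone (pt_lt_ptSucc j) (labelInt_ptSucc h)
  · intro h
    have h1 := labelInt_mono J h.le
    have h2 := labelInt_mono J (pt_lt_ptSucc j).le
    rw [labelInt_longest, labelInt_longest] at h1
    exact mem_of_labelInt_eq (by omega)

theorem longest_injective {n : ℕ} : Function.Injective (longest (n := n)) := by
  intro I J h
  ext j
  rw [mem_iff_longest, mem_iff_longest, h]

theorem labelInt_between {n : ℕ} {J : Finset (Fin n)} {x y z : Pt n} (h1 : x ≤ y) (h2 : y ≤ z)
    (h : labelInt J x = labelInt J z) : labelInt J y = labelInt J x := by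
  have := labelInt_mono J h1
  have := labelInt_mono J h2
  omega

theorem Pt.eq_add_one_of_forall {n : ℕ} {a b : Pt n} (hab : a < b)
    (h : ∀ c : Pt n, a < c → ¬ c < b) : b.1 = a.1 + 1 := by
  by_contra hn
  have ha := abs_le.mp a.2
  have hb := abs_le.mp b.2
  have hab : a.1 < b.1 := hab
  exact h ⟨a.1 + 1, abs_le.mpr ⟨by omega, by omega⟩⟩ (show a.1 < a.1 + 1 by omega)
    (show a.1 + 1 < b.1 by omega)

/-- An order-reversing involution of a component leaves no room between the images of two
neighbours. -/
theorem longest_adjacent {n : ℕ} {J : Finset (Fin n)} {a b : Pt n} (hab : b.1 = a.1 + 1)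
    (hl : labelInt J a = labelInt J b) :
    ((longest J).1 a).1 = ((longest J).1 b).1 + 1 := by
  have hlt : a < b := Pt.lt_iff.mpr (by omega)
  refine Pt.eq_add_one_of_forall (longest_antitone hlt hl) fun c h1 h2 => ?_
  have hc := labelInt_between h1.le h2.le (by rw [labelInt_longest, labelInt_longest, hl])
  rw [labelInt_longest] at hc
  have e : (longest J).1 ((longest J).1 c) = c := by
    rw [← W.mul_apply, longest_mul_self]; rfl
  have hc' : labelInt J ((longest J).1 c) = labelInt J b := by rw [labelInt_longest, hc]
  rcases lt_trichotomy ((longest J).1 c) a with h | h | h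
  · have := longest_antitone (J := J) h (by omega)
    rw [e] at this
    exact absurd this h2.not_gt
  · rw [← h, e] at h2; exact lt_irrefl _ h2
  · rcases lt_trichotomy ((longest J).1 c) b with h' | h' | h'
    · rw [Pt.lt_iff] at h h'; omega
    · rw [← h', e] at h1; exact lt_irrefl _ h1
    · have := longest_antitone (J := J) h' (by omega)
      rw [e] at this
      exact absurd this h1.not_gt

/-! ### Block permutations -/

theorem isBlock_iff {n : ℕ} {I J : Finset (Fin n)} {y : W n} :
    IsBlock I J y ↔
      (∀ a b, labelInt J a = labelInt J b ↔ labelInt I (y.1 a) = labelInt I (y.1 b)) ∧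
      ∀ a b, a < b → labelInt J a = labelInt J b → y.1 a < y.1 b := by
  constructor
  · intro h
    refine ⟨fun a b => ?_, fun a b hab hl => ?_⟩
    · rw [labelInt_eq_iff, labelInt_eq_iff]; exact h.compSetoid_iff a b
    · exact h.strictMonoOn b ((labelInt_eq_iff J a b).mp hl) ((compSetoid J).refl b) hab
  · rintro ⟨h1, h2⟩
    have h1' : ∀ a b, compSetoid J a b ↔ compSetoid I (y.1 a) (y.1 b) := by
      intro a b; rw [← labelInt_eq_iff, ← labelInt_eq_iff]; exact h1 a b
    refine ⟨fun x => ?_, fun x a ha b hb hab => ?_⟩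
    · ext z
      constructor
      · rintro ⟨c, hc, rfl⟩
        exact (h1' c x).mp hc
      · intro hz
        refine ⟨(y⁻¹).1 z, (h1' _ x).mpr ?_, W.apply_inv_self y z⟩
        rw [W.apply_inv_self]; exact hz
    · refine h2 a b hab ((labelInt_eq_iff J a b).mpr ?_)
      exact (compSetoid J).trans ha ((compSetoid J).symm hb)

namespace IsBlock

variable {n : ℕ} {I J K : Finset (Fin n)} {y z : W n}

theorem labelInt_iff (h : IsBlock I J y) (a b : Pt n) :
    labelInt J a = labelInt J b ↔ labelInt I (y.1 a) = labelInt I (y.1 b) :=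
  (isBlock_iff.mp h).1 a b

theorem lt (h : IsBlock I J y) {a b : Pt n} (hab : a < b) (hl : labelInt J a = labelInt J b) :
    y.1 a < y.1 b := (isBlock_iff.mp h).2 a b hab hl

theorem one (J : Finset (Fin n)) : IsBlock J J (1 : W n) :=
  isBlock_iff.mpr ⟨fun _ _ => Iff.rfl, fun _ _ h _ => h⟩

theorem mul (h : IsBlock I J y) (h' : IsBlock J K z) : IsBlock I K (y * z) := by
  refine isBlock_iff.mpr ⟨fun a b => ?_, fun a b hab hl => ?_⟩
  · rw [h'.labelInt_iff, h.labelInt_iff]; rfl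
  · exact h.lt (h'.lt hab hl) ((h'.labelInt_iff a b).mp hl)

theorem inv (h : IsBlock I J y) : IsBlock J I y⁻¹ := by
  refine isBlock_iff.mpr ⟨fun a b => ?_, fun a b hab hl => ?_⟩
  · rw [h.labelInt_iff, W.apply_inv_self, W.apply_inv_self]
  · by_contra hn
    have h1 := lt_of_le_of_ne (not_lt.mp hn) ((y⁻¹).1.injective.ne hab.ne')
    have h2 := h.lt h1 (by rw [h.labelInt_iff, W.apply_inv_self, W.apply_inv_self, hl])
    rw [W.apply_inv_self, W.apply_inv_self] at h2
    exact absurd h2 hab.not_gt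

theorem adjacent (h : IsBlock I J y) {a b : Pt n} (hab : b.1 = a.1 + 1)
    (hl : labelInt J a = labelInt J b) : (y.1 b).1 = (y.1 a).1 + 1 := by
  have hlt : a < b := Pt.lt_iff.mpr (by omega)
  refine Pt.eq_add_one_of_forall (h.lt hlt hl) fun c h1 h2 => ?_
  have hl' := (h.labelInt_iff a b).mp hl
  have hc := labelInt_between h1.le h2.le hl'
  have h3 := h.inv.lt h1 hc.symm
  have h4 := h.inv.lt h2 (hc.trans hl')
  rw [W.inv_apply_self, Pt.lt_iff] at h3 h4
  omega

theorem conj_mem_parabolic (h : IsBlock I J y) {u : W n} (hu : u ∈ parabolic J) :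
    y * u * y⁻¹ ∈ parabolic I := by
  rw [mem_parabolic_iff] at hu ⊢
  intro x
  have h1 := (h.labelInt_iff (u.1 ((y⁻¹).1 x)) ((y⁻¹).1 x)).mp (hu _)
  rwa [W.apply_inv_self] at h1

/-- All inversions of `u` lie inside components of `J`, where `y` preserves the order and so undoes
none of them. -/
theorem len_mul (h : IsBlock I J y) {u : W n} (hu : u ∈ parabolic J) :
    len (y * u) = len y + len u := by
  rw [mem_parabolic_iff] at hu
  rw [len_mul_eq_iff]
  intro a b hab hlt
  refine h.lt hlt ?_
  have h1 := labelInt_mono J hab.le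
  have h2 := labelInt_mono J hlt.le
  rw [hu, hu] at *
  omega

/-- The conjugate `y w_J y⁻¹` lies in `W_I` and reverses every component of `I`, which characterises
`w_I`. -/
theorem mul_longest (h : IsBlock I J y) : y * longest J = longest I * y := by
  have : y * longest J * y⁻¹ = longest I := by
    refine eq_longest (h.conj_mem_parabolic (longest_spec J).1) fun a b hab hl => ?_
    refine h.lt (longest_antitone (h.inv.lt hab hl) ((h.inv.labelInt_iff a b).mp hl)) ?_
    rw [labelInt_longest, labelInt_longest, ← h.inv.labelInt_iff, hl]
  rw [← this, inv_mul_cancel_right]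

/-- `y` induces a bijection between the components, of which `J` has `2 (n - #J) + 1`. -/
theorem card_eq (h : IsBlock I J y) : I.card = J.card := by
  have hI : I.card + (n - I.card) = n :=
    Nat.add_sub_cancel' (by simpa using Finset.card_le_univ I)
  have hJ : J.card + (n - J.card) = n :=
    Nat.add_sub_cancel' (by simpa using Finset.card_le_univ J)
  have hc : ∀ k, Nat.card (Pt k) = 2 * k + 1 := by
    intro k
    have e : Pt k ≃ Finset.Icc (-(k : ℤ)) k :=
      Equiv.subtypeEquivRight fun x => by rw [Finset.mem_Icc, abs_le]
    rw [Nat.card_congr e, Nat.card_eq_fintype_card, Fintype.card_coe, Int.card_Icc]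
    omega
  have e := Nat.card_congr ((labelEquiv J hJ).symm.trans
    ((Quotient.congr y.1 h.compSetoid_iff).trans (labelEquiv I hI)))
  rw [hc, hc] at e
  omega

/-- Conjugation by a block permutation maps simple reflections to simple reflections. -/
theorem exists_conj_simple (h : IsBlock I J y) {j : Fin n} (hj : j ∈ J) :
    ∃ i ∈ I, simple i = y * simple j * y⁻¹ := by
  have hl := labelInt_ptSucc hj
  have hadj := h.adjacent (by rw [ptSucc_val, pt_val]) hl
  obtain ⟨i, hi, hc⟩ := exists_link_mem hadj ((h.labelInt_iff _ _).mp hl)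
  refine ⟨i, hi, ?_⟩
  -- Signed permutations fix `0`, so links at `0` correspond to links at `0`; this matters because
  -- `s_0` has a different shape.
  have h0 : (i : ℕ) = 0 ↔ (j : ℕ) = 0 := by
    have key : ∀ (y : W n) (a b : Pt n), a.1 = 0 → y.1 a = b → b.1 = 0 := by
      intro y a b ha hb; rw [← hb]; exact y.coe_apply_zero ha
    constructor
    · intro hi0
      have : (y⁻¹).1 (y.1 (pt j)) = pt j := W.inv_apply_self _ _
      rcases hc with ⟨h1, h2⟩ | ⟨h1, h2⟩
      · have := key y⁻¹ _ _ (by rw [h1, pt_val]; omega) this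
        rw [pt_val] at this; omega
      · have h3 := key y⁻¹ _ _ (by rw [h2, Pt.coe_neg, pt_val]; omega) (W.inv_apply_self y (ptSucc j))
        rw [ptSucc_val] at h3; omega
    · intro hj0
      rcases hc with ⟨h1, h2⟩ | ⟨h1, h2⟩
      · have := key y _ _ (by rw [pt_val]; omega) h1
        rw [pt_val] at this; omega
      · have := key y _ _ (by rw [pt_val]; omega) h1
        rw [Pt.coe_neg, ptSucc_val] at this; omega
  have hsw : ∀ a b : Pt n, y.1 * Equiv.swap a b * (y.1)⁻¹ = Equiv.swap (y.1 a) (y.1 b) :=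
    fun a b => (Equiv.swap_apply_apply y.1 a b).symm
  apply Subtype.ext
  change simplePerm i = y.1 * simplePerm j * (y.1)⁻¹
  unfold simplePerm
  by_cases hj0 : (j : ℕ) = 0
  · rw [if_pos hj0, if_pos (h0.mpr hj0), hsw, W.apply_neg]
    rcases hc with ⟨h1, h2⟩ | ⟨h1, h2⟩
    · rw [h2]
    · have h3 := y.coe_apply_zero (x := pt j) (by rw [pt_val]; omega)
      rw [h1, Pt.coe_neg, ptSucc_val] at h3
      omega
  · rw [if_neg hj0, if_neg fun e => hj0 (h0.mp e)]
    have e : ∀ s t : Equiv.Perm (Pt n), y.1 * (s * t) * (y.1)⁻¹ =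
        (y.1 * s * (y.1)⁻¹) * (y.1 * t * (y.1)⁻¹) := fun s t => by group
    rw [e, hsw, hsw, W.apply_neg, W.apply_neg]
    rcases hc with ⟨h1, h2⟩ | ⟨h1, h2⟩
    · rw [h1, h2]
    · rw [h1, h2, Pt.neg_neg, Pt.neg_neg]
      -- When `y` moves the link to the negative side, the two transpositions of `s_i` appear in the
      -- opposite order; they are disjoint and commute.
      have hcomm : ∀ a b : Pt n, a ≠ b → a ≠ -a → b ≠ -b → a ≠ -b →
          Equiv.swap a b * Equiv.swap (-a) (-b) = Equiv.swap (-b) (-a) * Equiv.swap b a := by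
        intro a b h1 h2 h3 h4
        rw [Equiv.swap_comm b a, Equiv.swap_comm (-b) (-a)]
        apply Equiv.Perm.Disjoint.commute
        have h5 : b ≠ -a := fun e => h4 (by rw [e, Pt.neg_neg])
        intro z
        by_cases hz : z = a ∨ z = b
        · right
          rcases hz with rfl | rfl
          · exact Equiv.swap_apply_of_ne_of_ne h2 h4
          · exact Equiv.swap_apply_of_ne_of_ne h5 h3
        · left
          push Not at hz
          exact Equiv.swap_apply_of_ne_of_ne hz.1 hz.2
      have hi0 : (i : ℕ) ≠ 0 := fun e => hj0 (h0.mp e)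
      apply hcomm <;> simp only [ne_eq, Subtype.ext_iff, Pt.coe_neg, pt_val, ptSucc_val] <;> omega

/-- Left factors from `W_I` can be moved past `y` into `W_J`, so the double coset is the single left
coset `y W_J`. -/
theorem mem_carrier_iff (h : IsBlock I J y) (z : W n) :
    z ∈ (cosetOf I J y).carrier ↔ ∃ u ∈ parabolic J, z = y * u := by
  change z ∈ DoubleCoset.doubleCoset y _ _ ↔ _
  rw [DoubleCoset.mem_doubleCoset]
  constructor
  · rintro ⟨a, ha, b, hb, rfl⟩
    have := h.inv.conj_mem_parabolic ha
    rw [inv_inv] at this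
    exact ⟨y⁻¹ * a * y * b, mul_mem this hb, by group⟩
  · rintro ⟨u, hu, rfl⟩
    exact ⟨1, one_mem _, u, hu, by group⟩

/-- The chosen minimal element is `y * u` of length `len y + len u`, which forces `u = 1`. The
maximal element is found in the same way, with `u` of maximal length in `W_J`. -/
theorem min_cosetOf (h : IsBlock I J y) : (cosetOf I J y).min = y := by
  have hy : y ∈ (cosetOf I J y).carrier := (h.mem_carrier_iff y).mpr ⟨1, one_mem _, by simp⟩
  obtain ⟨h1, h2⟩ := minElt_spec ⟨y, hy⟩
  change (cosetOf I J y).min ∈ _ at h1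
  obtain ⟨u, hu, e⟩ := (h.mem_carrier_iff _).mp h1
  have h3 := h2 y hy
  change len (cosetOf I J y).min ≤ _ at h3
  rw [e, h.len_mul hu] at h3
  rw [e, eq_one_of_len (w := u) (by omega), mul_one]

theorem max_cosetOf (h : IsBlock I J y) : (cosetOf I J y).max = y * longest J := by
  have hy : y ∈ (cosetOf I J y).carrier := (h.mem_carrier_iff y).mpr ⟨1, one_mem _, by simp⟩
  obtain ⟨h1, h2⟩ := maxElt_spec ⟨y, hy⟩
  change (cosetOf I J y).max ∈ _ at h1
  change ∀ z ∈ _, len z ≤ len (cosetOf I J y).max at h2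
  obtain ⟨u, hu, e⟩ := (h.mem_carrier_iff _).mp h1
  rw [e]
  congr 1
  refine eq_longest hu fun a b hab hl => antitone_of_maximal hu (fun z hz => ?_) hab hl
  have h3 := h2 _ ((h.mem_carrier_iff _).mpr ⟨z, hz, rfl⟩)
  rw [e, h.len_mul hu, h.len_mul hz] at h3
  omega

theorem isCore_cosetOf (h : IsBlock I J y) : (cosetOf I J y).IsCore := by
  unfold Coset.IsCore Coset.leftRed Coset.rightRed
  rw [h.min_cosetOf]
  constructor
  · ext i
    refine ⟨fun hi => hi.1, fun hi => ⟨hi, ?_⟩⟩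
    obtain ⟨j, hj, e⟩ := h.inv.exists_conj_simple hi
    exact ⟨j, hj, by rw [e]; group⟩
  · ext j
    refine ⟨fun hj => hj.1, fun hj => ⟨hj, ?_⟩⟩
    obtain ⟨i, hi, e⟩ := h.exists_conj_simple hj
    exact ⟨i, hi, by rw [e]; group⟩

end IsBlock

/-! ### Minimal elements of core cosets are block permutations -/

namespace Coset

variable {n : ℕ} {I J : Finset (Fin n)}

theorem carrier_nonempty (p : Coset I J) : p.carrier.Nonempty := by
  obtain ⟨w, hw⟩ := p.isDoubleCoset
  exact ⟨w, by rw [hw]; exact DoubleCoset.mem_doubleCoset_self _ _ _⟩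

theorem eq_cosetOf_of_mem (p : Coset I J) {z : W n} (hz : z ∈ p.carrier) : p = cosetOf I J z := by
  obtain ⟨w, hw⟩ := p.isDoubleCoset
  ext1
  rw [hw] at hz ⊢
  exact (DoubleCoset.doubleCoset_eq_of_mem hz).symm

theorem min_spec (p : Coset I J) : p.min ∈ p.carrier ∧ ∀ z ∈ p.carrier, len p.min ≤ len z :=
  minElt_spec p.carrier_nonempty

theorem eq_cosetOf_min (p : Coset I J) : p = cosetOf I J p.min :=
  p.eq_cosetOf_of_mem p.min_spec.1

theorem min_mul_mem (p : Coset I J) {u : W n} (hu : u ∈ parabolic J) : p.min * u ∈ p.carrier := by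
  have h : p.min * u ∈ (cosetOf I J p.min).carrier :=
    DoubleCoset.mem_doubleCoset.mpr ⟨1, one_mem _, u, hu, by group⟩
  rwa [← p.eq_cosetOf_min] at h

theorem min_ascent (p : Coset I J) {j : Fin n} (hj : j ∈ J) :
    p.min.1 (pt j) < p.min.1 (ptSucc j) := by
  by_contra hn
  have h1 := len_mul_simple_of_descent
    (lt_of_le_of_ne (not_lt.mp hn) (apply_pt_ne p.min j).symm)
  have h2 := p.min_spec.2 _ (p.min_mul_mem (simple_mem_parabolic hj))
  omega

/-- Evaluating `s_i y = y s_j` at `j + 1` determines the images of the link up to sign and order,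
and minimality makes `y` increase along it. -/
theorem min_link (p : Coset I J) {i j : Fin n} (hj : j ∈ J)
    (h : simple i = p.min * simple j * p.min⁻¹) :
    (p.min.1 (pt j) = pt i ∧ p.min.1 (ptSucc j) = ptSucc i) ∨
      (p.min.1 (pt j) = -ptSucc i ∧ p.min.1 (ptSucc j) = -pt i) := by
  have hasc := p.min_ascent hj
  generalize p.min = y at *
  have hx : (simple i).1 (y.1 (ptSucc j)) = y.1 ((simple j).1 (ptSucc j)) := by
    rw [h, ← W.mul_apply, ← W.mul_apply]; congr 2; group
  have h1 := simple_apply_val i (y.1 (ptSucc j))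
  rw [hx] at h1
  have h0 := fun h => y.coe_apply_zero (x := pt j) h
  rw [pt_val] at h0
  rw [Pt.lt_iff] at hasc
  simp only [Subtype.ext_iff, Pt.coe_neg, pt_val, ptSucc_val]
  -- Here `s_0` sends `1` to `-1`, so `s_i` negates `y 1`; together with `y 1 > y 0 = 0` this forces
  -- `i = 0` and `y 1 = 1`.
  by_cases hj0 : (j : ℕ) = 0
  · have e : (simple j).1 (ptSucc j) = -ptSucc j := Subtype.ext (by
      rw [simple_apply_val, if_pos (ptSucc_val j), if_pos hj0, Pt.coe_neg, ptSucc_val, hj0]; rfl)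
    rw [e, W.apply_neg, Pt.coe_neg] at h1
    have := h0 (by omega)
    split_ifs at h1 <;> omega
  · have e : (simple j).1 (ptSucc j) = pt j := Subtype.ext (by
      rw [simple_apply_val, if_pos (ptSucc_val j), if_neg hj0, pt_val])
    -- This rules out `i = 0`, where `s_i` could send `y (j + 1)` to its negative.
    have hne : (y.1 (pt j)).1 ≠ -(y.1 (ptSucc j)).1 := by
      rw [← Pt.coe_neg, ← W.apply_neg]
      intro e
      have := congrArg Subtype.val (y.1.injective (Subtype.ext e))
      rw [Pt.coe_neg, pt_val, ptSucc_val] at this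
      omega
    rw [e] at h1
    split_ifs at h1 <;> omega

/-- Components are chains of links. Right redundancy carries links of `J` to links of `I`, left
redundancy does the same for the inverse, and minimality gives monotonicity on components. -/
theorem IsCore.isBlock {p : Coset I J} (h : p.IsCore) : IsBlock I J p.min := by
  have h1 : ∀ i ∈ I, ∃ j ∈ J, simple i = p.min * simple j * p.min⁻¹ := fun i hi =>
    (h.1.superset hi : i ∈ p.leftRed).2
  have h2 : ∀ j ∈ J, ∃ i ∈ I, simple i = p.min * simple j * p.min⁻¹ := by
    intro j hj
    obtain ⟨i, hi, e⟩ := (h.2.superset hj : j ∈ p.rightRed).2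
    exact ⟨i, hi, by rw [e]; group⟩
  have hlink := fun i j => p.min_link (i := i) (j := j)
  have hasc := fun j => p.min_ascent (j := j)
  generalize p.min = y at *
  refine isBlock_iff.mpr ⟨fun a b => ⟨?_, ?_⟩, fun a b => lt_of_ascents hasc⟩
  · have key := rel_of_adjacent J (fun a b => labelInt I (y.1 a) = labelInt I (y.1 b))
      (fun _ _ _ => Eq.trans) ?_
    · intro hl
      rcases lt_trichotomy a b with hab | rfl | hab
      · exact key a b hab hl
      · rfl
      · exact (key b a hab hl.symm).symm
    · intro a b hab hl
      obtain ⟨j, hj, hab⟩ := exists_link_mem hab hl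
      obtain ⟨i, hi, e⟩ := h2 j hj
      have hli := labelInt_ptSucc hi
      have : labelInt I (y.1 (pt j)) = labelInt I (y.1 (ptSucc j)) := by
        rcases hlink i j hj e with ⟨e1, e2⟩ | ⟨e1, e2⟩
        · rw [e1, e2, hli]
        · rw [e1, e2, labelInt_neg, labelInt_neg, hli]
      rcases hab with ⟨rfl, rfl⟩ | ⟨rfl, rfl⟩
      · exact this
      · rw [W.apply_neg, W.apply_neg, labelInt_neg, labelInt_neg, this]
  · have key := rel_of_adjacent I (fun a b => labelInt J ((y⁻¹).1 a) = labelInt J ((y⁻¹).1 b))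
      (fun _ _ _ => Eq.trans) ?_
    · intro hl
      rcases lt_trichotomy (y.1 a) (y.1 b) with hab | hab | hab
      · simpa only [W.inv_apply_self] using key _ _ hab hl
      · rw [y.1.injective hab]
      · simpa only [W.inv_apply_self] using (key _ _ hab hl.symm).symm
    · intro a b hab hl
      obtain ⟨i, hi, hab⟩ := exists_link_mem hab hl
      obtain ⟨j, hj, e⟩ := h1 i hi
      have hlj := labelInt_ptSucc hj
      have : labelInt J ((y⁻¹).1 (pt i)) = labelInt J ((y⁻¹).1 (ptSucc i)) := by
        rcases hlink i j hj e with ⟨e1, e2⟩ | ⟨e1, e2⟩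
        · rw [← e1, ← e2, W.inv_apply_self, W.inv_apply_self, hlj]
        · have e3 : pt i = y.1 (-ptSucc j) := by rw [W.apply_neg, e2, Pt.neg_neg]
          have e4 : ptSucc i = y.1 (-pt j) := by rw [W.apply_neg, e1, Pt.neg_neg]
          rw [e3, e4, W.inv_apply_self, W.inv_apply_self, labelInt_neg, labelInt_neg, hlj]
      rcases hab with ⟨rfl, rfl⟩ | ⟨rfl, rfl⟩
      · exact this
      · rw [W.apply_neg, W.apply_neg, labelInt_neg, labelInt_neg, this]

theorem IsCore.max_eq {p : Coset I J} (h : p.IsCore) : p.max = p.min * longest J := by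
  conv_lhs => rw [p.eq_cosetOf_min]
  exact h.isBlock.max_cosetOf

end Coset

/-! ### Squashing block permutations -/

theorem label_val {n k : ℕ} (J : Finset (Fin n)) (hJ : J.card + k = n) (x : Pt n) :
    (label J hJ x).1 = labelInt J x := rfl

namespace IsBlock

variable {n k : ℕ} {I J K : Finset (Fin n)} {y z : W n}

theorem card_add (h : IsBlock I J y) (hJ : J.card + k = n) : I.card + k = n := by
  rw [h.card_eq, hJ]

theorem squash_label (h : IsBlock I J y) (hI : I.card + k = n) (hJ : J.card + k = n) (x : Pt n) :
    (squash k (cosetOf I J y)).1 (label J hJ x) = label I hI (y.1 x) := by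
  have hm := h.min_cosetOf
  unfold squash
  have hb : IsBlock I J (cosetOf I J y).min := by rwa [hm]
  rw [dif_pos ⟨hI, hJ, hb⟩]
  change squashPerm hI hJ hb _ = _
  rw [squashPerm_label, hm]

theorem squash_labelInt (h : IsBlock I J y) (hJ : J.card + k = n) (x : Pt n) :
    ((squash k (cosetOf I J y)).1 (label J hJ x)).1 = labelInt I (y.1 x) := by
  rw [h.squash_label (h.card_add hJ) hJ]; rfl

theorem squash_mul (h : IsBlock I J y) (h' : IsBlock J K z) (hJ : J.card + k = n) :
    squash k (cosetOf I K (y * z)) = squash k (cosetOf I J y) * squash k (cosetOf J K z) := by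
  have hK : K.card + k = n := by rw [← h'.card_eq, hJ]
  have hI := h.card_add hJ
  refine W.ext' fun c => ?_
  obtain ⟨x, rfl⟩ := label_surjective K hK c
  rw [W.mul_apply, (h.mul h').squash_label hI hK, h'.squash_label hJ hK, h.squash_label hI hJ]
  rfl

theorem squash_one (hJ : J.card + k = n) : squash k (cosetOf J J (1 : W n)) = 1 := by
  refine W.ext' fun c => ?_
  obtain ⟨x, rfl⟩ := label_surjective J hJ c
  rw [(IsBlock.one J).squash_label hJ hJ]; rfl

theorem squash_inv (h : IsBlock I J y) (hJ : J.card + k = n) :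
    squash k (cosetOf J I y⁻¹) = (squash k (cosetOf I J y))⁻¹ := by
  rw [eq_inv_iff_mul_eq_one, ← h.inv.squash_mul h (h.card_add hJ), inv_mul_cancel, squash_one hJ]

/-- If the labels do not move, `y` is increasing both between and inside components, hence trivial;
equal labels then mean equal sets. -/
theorem eq_one_of_squash (h : IsBlock I J y) (hJ : J.card + k = n)
    (hs : squash k (cosetOf I J y) = 1) : y = 1 ∧ I = J := by
  have hl : ∀ x, labelInt I (y.1 x) = labelInt J x := by
    intro x
    rw [← h.squash_labelInt hJ, hs]; rfl
  have hy : y = 1 := by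
    refine eq_one_of_strictMono fun a b hab => ?_
    rcases (labelInt_mono J hab.le).lt_or_eq with h1 | h1
    · rw [← hl, ← hl] at h1
      exact lt_of_labelInt_lt h1
    · exact h.lt hab h1
  refine ⟨hy, ?_⟩
  subst hy
  have hl : ∀ x, labelInt I x = labelInt J x := hl
  ext j
  constructor
  · intro hj
    apply mem_of_labelInt_eq
    rw [← hl, ← hl]; exact labelInt_ptSucc hj
  · intro hj
    apply mem_of_labelInt_eq
    rw [hl, hl]; exact labelInt_ptSucc hj

/-- A block permutation and its source are determined by the target and the squashed
permutation. -/
theorem eq_of_squash_left {J' : Finset (Fin n)} (h : IsBlock I J y) (h' : IsBlock I J' z)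
    (hI : I.card + k = n) (hs : squash k (cosetOf I J y) = squash k (cosetOf I J' z)) :
    y = z ∧ J = J' := by
  have hJ : J.card + k = n := by rw [← h.card_eq, hI]
  have hJ' : J'.card + k = n := by rw [← h'.card_eq, hI]
  have h1 := (h.inv.mul h').eq_one_of_squash hJ' (by
    rw [h.inv.squash_mul h' hI, h.squash_inv hJ, hs, inv_mul_cancel])
  exact ⟨inv_mul_eq_one.mp h1.1, h1.2⟩

/-- A block permutation and its target are determined by the source and the squashed
permutation. -/
theorem eq_of_squash_right {I' : Finset (Fin n)} (h : IsBlock I J y) (h' : IsBlock I' J z)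
    (hJ : J.card + k = n) (hs : squash k (cosetOf I J y) = squash k (cosetOf I' J z)) :
    y = z ∧ I = I' := by
  have h1 := h.inv.eq_of_squash_left h'.inv hJ (by rw [h.squash_inv hJ, h'.squash_inv hJ, hs])
  exact ⟨inv_injective h1.1, h1.2⟩

/-- Squashing preserves and reflects the additivity of lengths. -/
theorem len_mul_eq_iff_squash (h : IsBlock I J y) (h' : IsBlock J K z) (hJ : J.card + k = n) :
    len (y * z) = len y + len z ↔
      len (squash k (cosetOf I J y) * squash k (cosetOf J K z)) =
        len (squash k (cosetOf I J y)) + len (squash k (cosetOf J K z)) := by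
  have hK : K.card + k = n := by rw [← h'.card_eq, hJ]
  have hI := h.card_add hJ
  rw [len_mul_eq_iff, len_mul_eq_iff]
  constructor
  · intro hlen c d
    obtain ⟨a, rfl⟩ := label_surjective K hK c
    obtain ⟨b, rfl⟩ := label_surjective K hK d
    simp only [h'.squash_label hJ hK, h.squash_label hI hJ, Pt.lt_iff, label_val]
    intro h1 h2
    have h3 := hlen a b (lt_of_labelInt_lt h1) (lt_of_labelInt_lt h2)
    refine lt_of_le_of_ne (labelInt_mono I h3.le) fun e => ?_
    have := (h.labelInt_iff _ _).mpr e
    omega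
  · intro hlen a b hab hz
    have h1 : labelInt K a < labelInt K b := by
      refine lt_of_le_of_ne (labelInt_mono K hab.le) fun e => ?_
      exact absurd (h'.lt hab e) hz.not_gt
    have h2 : labelInt J (z.1 b) < labelInt J (z.1 a) := by
      refine lt_of_le_of_ne (labelInt_mono J hz.le) fun e => ?_
      have := (h'.labelInt_iff _ _).mpr e
      omega
    have h3 := hlen (label K hK a) (label K hK b)
    simp only [h'.squash_label hJ hK, h.squash_label hI hJ, Pt.lt_iff, label_val] at h3
    exact lt_of_labelInt_lt (h3 h1 h2)

end IsBlock

theorem Coset.squash_eq {n : ℕ} {I J : Finset (Fin n)} (p : Coset I J) (k : ℕ) : squash k p = squash k (cosetOf I J p.min) := by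
  rw [← p.eq_cosetOf_min]

/-! ### Links: the minimal elements of atomic cosets -/

theorem gaps_insert {n : ℕ} {J : Finset (Fin n)} {t : Fin n} (ht : t ∉ J) (a : ℕ) :
    gaps (insert t J) a + (if (t : ℕ) < a then 1 else 0) = gaps J a := by
  unfold gaps
  split_ifs with h
  · rw [← Finset.card_insert_of_notMem (a := t) (by simp)]
    congr 1
    ext d
    simp only [Finset.mem_insert, Finset.mem_filter, Finset.mem_univ, true_and, not_or]
    constructor
    · rintro (rfl | ⟨⟨_, h2⟩, h3⟩)
      · exact ⟨ht, h⟩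
      · exact ⟨h2, h3⟩
    · rintro ⟨h1, h2⟩
      by_cases e : d = t
      · exact Or.inl e
      · exact Or.inr ⟨⟨e, h1⟩, h2⟩
  · rw [add_zero]
    congr 1
    ext d
    simp only [Finset.mem_insert, Finset.mem_filter, Finset.mem_univ, true_and, not_or]
    constructor
    · rintro ⟨⟨_, h2⟩, h3⟩
      exact ⟨h2, h3⟩
    · rintro ⟨h1, h2⟩
      exact ⟨⟨fun e => h (by rwa [← e]), h1⟩, h2⟩

theorem gaps_empty {n : ℕ} (a : ℕ) (ha : a ≤ n) : gaps (∅ : Finset (Fin n)) a = a := by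
  induction a with
  | zero => exact gaps_zero _
  | succ a ih =>
    have := gaps_succ (∅ : Finset (Fin n)) ⟨a, ha⟩
    simp only [Finset.notMem_empty, if_false] at this
    rw [this, ih (by omega)]

theorem lt_iff_gaps_lt {n : ℕ} {J : Finset (Fin n)} {t : Fin n} (ht : t ∉ J) (a : ℕ) :
    (t : ℕ) < a ↔ gaps J t < gaps J a := by
  constructor
  · intro h
    have h1 := gaps_mono J (show (t : ℕ) + 1 ≤ a from h)
    rw [gaps_succ, if_neg ht] at h1
    omega
  · intro h
    by_contra hn
    have := gaps_mono J (not_lt.mp hn)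
    omega

theorem gaps_singleton_add {k : ℕ} (c : Fin k) {a : ℕ} (ha : a ≤ k) :
    gaps {c} a + (if (c : ℕ) < a then 1 else 0) = a := by
  have := gaps_insert (Finset.notMem_empty c) a
  rwa [gaps_empty a ha] at this

theorem gaps_le {n k : ℕ} {J : Finset (Fin n)} (hJ : J.card + k = n) {a : ℕ} (ha : a ≤ n) :
    gaps J a ≤ k := by
  have h1 := gaps_top J
  have h2 := gaps_mono J ha
  omega

theorem gaps_lt {n k : ℕ} {J : Finset (Fin n)} (hJ : J.card + k = n) {t : Fin n} (ht : t ∉ J) :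
    gaps J t < k :=
  ((lt_iff_gaps_lt ht n).mp t.2).trans_le (gaps_le hJ le_rfl)

/-- Merging two neighbouring components of `J` merges two neighbouring labels. -/
theorem labelInt_label {n k : ℕ} {J : Finset (Fin n)} (hJ : J.card + k = n) {t : Fin n}
    (ht : t ∉ J) {c : Fin k} (hc : (c : ℕ) = gaps J t) (x : Pt n) :
    labelInt {c} (label J hJ x) = labelInt (insert t J) x := by
  have key : ∀ a : ℕ, a ≤ n → gaps {c} (gaps J a) = gaps (insert t J) a := by
    intro a ha
    have h1 := gaps_singleton_add c (gaps_le hJ ha)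
    have h2 := gaps_insert ht a
    have h3 := lt_iff_gaps_lt ht a
    rw [hc] at h1
    simp only [h3] at h2
    omega
  have hx := abs_le.mp x.2
  have hk := key x.1.natAbs (by omega)
  rcases le_total 0 x.1 with h | h
  · have e := labelInt_of_nonneg J h
    have e' : (label J hJ x).1.natAbs = gaps J x.1.natAbs := by rw [label_val, e]; simp
    rw [labelInt_of_nonneg _ h, labelInt_of_nonneg _ (by rw [label_val, e]; omega), e', hk]
  · have e := labelInt_of_nonpos J h
    have e' : (label J hJ x).1.natAbs = gaps J x.1.natAbs := by rw [label_val, e]; simp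
    rw [labelInt_of_nonpos _ h, labelInt_of_nonpos _ (by rw [label_val, e]; omega), e', hk]

theorem labelInt_singleton {k : ℕ} (c : Fin k) (x : Pt k) :
    (-(c : ℤ) ≤ x.1 ∧ x.1 ≤ c ∧ labelInt {c} x = x.1) ∨ ((c : ℤ) < x.1 ∧ labelInt {c} x = x.1 - 1) ∨
      (x.1 < -(c : ℤ) ∧ labelInt {c} x = x.1 + 1) := by
  have hx := abs_le.mp x.2
  have h1 := gaps_singleton_add c (a := x.1.natAbs) (by omega)
  rcases le_total 0 x.1 with h | h
  · rw [labelInt_of_nonneg _ h]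
    split_ifs at h1 <;> omega
  · rw [labelInt_of_nonpos _ h]
    split_ifs at h1 <;> omega

theorem mem_parabolic_singleton {k : ℕ} {c : Fin k} {w : W k} (h : w ∈ parabolic {c}) :
    w = 1 ∨ w = simple c := by
  unfold parabolic at h
  rw [Finset.coe_singleton, Set.image_singleton, Subgroup.mem_closure_singleton] at h
  obtain ⟨m, rfl⟩ := h
  have h2 : simple c ^ (2 : ℤ) = 1 := by
    rw [zpow_two, simple_mul_self]
  rcases Int.even_or_odd' m with ⟨m, rfl | rfl⟩
  · left; rw [zpow_mul, h2, one_zpow]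
  · right; rw [zpow_add, zpow_mul, h2, one_zpow, one_mul, zpow_one]

/-- `y` is the minimal element of the atomic coset with reduced expression `[I, K, J]`. -/
structure IsLink {n : ℕ} (I K J : Finset (Fin n)) (y : W n) : Prop where
  block : IsBlock I J y
  left : ∃ s ∉ I, K = insert s I
  right : ∃ t ∉ J, K = insert t J
  mul_longest_eq : y * longest J = longest K

theorem parabolic_mono {n : ℕ} {I J : Finset (Fin n)} (h : I ⊆ J) : parabolic I ≤ parabolic J :=
  Subgroup.closure_mono (Set.image_mono h)

theorem labelInt_eq_of_subset {n : ℕ} {J K : Finset (Fin n)} (h : J ⊆ K) {a b : Pt n}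
    (hl : labelInt J a = labelInt J b) : labelInt K a = labelInt K b := by
  have key := rel_of_adjacent J (fun a b => labelInt K a = labelInt K b) (fun _ _ _ => Eq.trans)
    (by
      intro a b hab hl
      obtain ⟨j, hj, ⟨rfl, rfl⟩ | ⟨rfl, rfl⟩⟩ := exists_link_mem hab hl
      · exact labelInt_ptSucc (h hj)
      · rw [labelInt_neg, labelInt_neg, labelInt_ptSucc (h hj)])
  rcases lt_trichotomy a b with hab | rfl | hab
  · exact key a b hab hl
  · rfl
  · exact (key b a hab hl.symm).symm

namespace IsLink

variable {n k : ℕ} {I J K : Finset (Fin n)} {y : W n}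

theorem eq (h : IsLink I K J y) : y = longest K * longest J := by
  rw [← h.mul_longest_eq, mul_assoc, longest_mul_self, mul_one]

/-- By `mul_longest`, also `w_K = w_I y`; inverting this gives `y⁻¹ w_I = w_K`. -/
theorem inv (h : IsLink I K J y) : IsLink J K I y⁻¹ := by
  refine ⟨h.block.inv, h.right, h.left, ?_⟩
  have h1 := h.block.mul_longest
  rw [h.mul_longest_eq] at h1
  have h2 := congrArg (fun g => g⁻¹) h1
  simp only [mul_inv_rev, longest_inv] at h2
  exact h2.symm

theorem mem_parabolic (h : IsLink I K J y) : y ∈ parabolic K := by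
  obtain ⟨t, _, ht⟩ := h.right
  rw [h.eq]
  refine mul_mem (longest_spec K).1 (parabolic_mono ?_ (longest_spec J).1)
  rw [ht]; exact Finset.subset_insert _ _

/-- As `y ∈ W_K`, it preserves the labels of `K`, which are the labels of `J` or `I` with neighbours
merged. So the squash lies in a parabolic subgroup of rank one; it is not `1`, since that would give
`w_J = w_K`. -/
theorem squash_eq_simple {t : Fin n} (h : IsLink I (insert t J) J y) (ht : t ∉ J)
    (hJ : J.card + k = n) {c : Fin k} (hc : (c : ℕ) = gaps J t) :
    squash k (cosetOf I J y) = simple c := by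
  obtain ⟨s, hs, hK⟩ := h.left
  have hI := h.block.card_add hJ
  have hy := mem_parabolic_iff.mp h.mem_parabolic
  let c' : Fin k := ⟨gaps I s, gaps_lt hI hs⟩
  have hσ : ∀ p, labelInt {c'} ((squash k (cosetOf I J y)).1 p) = labelInt {c} p := by
    intro p
    obtain ⟨x, rfl⟩ := label_surjective J hJ p
    rw [h.block.squash_label hI hJ, labelInt_label hJ ht hc, labelInt_label hI hs rfl, ← hK, hy]
  have hne : squash k (cosetOf I J y) ≠ 1 := by
    intro e
    have h1 := (h.block.eq_one_of_squash hJ e).1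
    have h2 := h.mul_longest_eq
    rw [h1, one_mul] at h2
    have h3 := longest_injective h2
    exact ht (by rw [h3]; exact Finset.mem_insert_self _ _)
  generalize squash k (cosetOf I J y) = σ at *
  -- The points `c` and `c + 1` both have merged label `c`, so their distinct images share the label
  -- `c` for `c'`. The only non-negative label with several points there is `c'`.
  have hcc : c' = c := by
    have h1 := hσ (pt c)
    have h2 := hσ (ptSucc c)
    have h3 := apply_pt_ne σ c
    have h4 := labelInt_singleton c (pt c)
    have h5 := labelInt_singleton c (ptSucc c)
    have h6 := labelInt_singleton c' (σ.1 (pt c))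
    have h7 := labelInt_singleton c' (σ.1 (ptSucc c))
    rw [ne_eq, Subtype.ext_iff] at h3
    rw [pt_val] at h4
    rw [ptSucc_val] at h5
    apply Fin.ext
    omega
  rw [hcc] at hσ
  exact (mem_parabolic_singleton (mem_parabolic_iff.mpr hσ)).resolve_left hne

theorem exists_squash_eq_simple (h : IsLink I K J y) (hJ : J.card + k = n) :
    ∃ c : Fin k, squash k (cosetOf I J y) = simple c := by
  obtain ⟨t, ht, rfl⟩ := h.right
  exact ⟨⟨gaps J t, gaps_lt hJ ht⟩, h.squash_eq_simple ht hJ rfl⟩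

theorem not_subset (h : IsLink I K J y) : ¬ K ⊆ J := by
  obtain ⟨t, ht, rfl⟩ := h.right
  exact fun hn => ht (hn (Finset.mem_insert_self _ _))

theorem subset (h : IsLink I K J y) : I ⊆ K := by
  obtain ⟨t, ht, rfl⟩ := h.left
  exact Finset.subset_insert _ _

theorem max_cosetOf (h : IsLink I K J y) : (cosetOf I J y).max = longest K := by
  rw [h.block.max_cosetOf, h.mul_longest_eq]

theorem stepProd_cons (h : IsLink I K J y) (L : List (Finset (Fin n))) :
    stepProd (I :: K :: J :: L) = (longest I)⁻¹ * longest K * stepProd (J :: L) := by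
  rw [stepProd, stepProd, if_pos h.subset, if_neg h.not_subset, one_mul]

theorem stepLen_cons (h : IsLink I K J y) (L : List (Finset (Fin n))) :
    stepLen (I :: K :: J :: L) = len (longest K) - len (longest I) + stepLen (J :: L) := by
  rw [stepLen, stepLen, if_pos h.subset, if_neg h.not_subset, zero_add]

theorem isStep_left (h : IsLink I K J y) : IsStep I K := Or.inl h.left

theorem isStep_right (h : IsLink I K J y) : IsStep K J := by
  obtain ⟨t, ht, rfl⟩ := h.right
  exact Or.inr ⟨t, Finset.mem_insert_self _ _, (Finset.erase_insert ht).symm⟩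

theorem isReducedExpr (h : IsLink I K J y) : IsReducedExpr (cosetOf I J y) [I, K, J] := by
  refine ⟨⟨rfl, rfl, ?_⟩, ?_, ?_⟩
  · simp [h.isStep_left, h.isStep_right]
  · rw [h.max_cosetOf, h.stepProd_cons]
    simp [stepProd]
  · rw [h.max_cosetOf, h.stepLen_cons]
    simp [stepLen]

theorem isAtomic (h : IsLink I K J y) : (cosetOf I J y).IsAtomic := by
  refine ⟨h.block.isCore_cosetOf, ?_⟩
  obtain ⟨s, hs, e⟩ := h.left
  obtain ⟨t, ht, e'⟩ := h.right
  refine ⟨s, t, hs, ?_, ?_⟩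
  · rw [← e, e']; exact Finset.mem_insert_self _ _
  · rw [← e]
    have : K.erase t = J := by rw [e', Finset.erase_insert ht]
    rw [this]
    exact h.isReducedExpr

/-- Since `w_K = y w_J`, the coset used by `squashExpr` is the coset of the block permutation `y`.
-/
theorem cosetOf_longest (h : IsLink I K J y) : cosetOf I J (longest K) = cosetOf I J y := by
  refine ((cosetOf I J y).eq_cosetOf_of_mem ?_).symm
  rw [h.block.mem_carrier_iff, ← h.mul_longest_eq]
  exact ⟨_, (longest_spec J).1, rfl⟩

end IsLink

/-- Every `t ∉ J` gives rise to an atomic coset with a reduced expression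
`[I, insert t J, J]`. -/
theorem exists_isLink {n : ℕ} {J : Finset (Fin n)} {t : Fin n} (ht : t ∉ J) :
    ∃ I y, IsLink I (insert t J) J y := by
  classical
  have hsub : J ⊆ insert t J := Finset.subset_insert _ _
  obtain ⟨y, hy⟩ : ∃ y, y = longest (insert t J) * longest J := ⟨_, rfl⟩
  have hyK : y ∈ parabolic (insert t J) := by
    rw [hy]; exact mul_mem (longest_spec _).1 (parabolic_mono hsub (longest_spec J).1)
  have hyK' := mem_parabolic_iff.mp hyK
  -- Both `w_J` and `w_K` send neighbours in a component to neighbours in reversed order, and the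
  -- two reversals cancel.
  have hadj : ∀ a b : Pt n, b.1 = a.1 + 1 → labelInt J a = labelInt J b →
      (y.1 b).1 = (y.1 a).1 + 1 := by
    intro a b hab hl
    rw [hy, W.mul_apply, W.mul_apply]
    refine longest_adjacent (longest_adjacent hab hl) (labelInt_eq_of_subset hsub ?_)
    rw [labelInt_longest, labelInt_longest, hl]
  -- The target is forced: its links must be the neighbouring pairs that come from one component of
  -- `J`.
  let I : Finset (Fin n) :=
    {i | labelInt J ((y⁻¹).1 (pt i)) = labelInt J ((y⁻¹).1 (ptSucc i))}
  have hI : ∀ i, i ∈ I ↔ labelInt J ((y⁻¹).1 (pt i)) = labelInt J ((y⁻¹).1 (ptSucc i)) := by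
    intro i; simp [I]
  have hblock : IsBlock I J y := by
    refine isBlock_iff.mpr ⟨fun a b => ⟨?_, ?_⟩, fun a b hab hl => ?_⟩
    · have key := rel_of_adjacent J (fun a b => labelInt I (y.1 a) = labelInt I (y.1 b))
        (fun _ _ _ => Eq.trans) ?_
      · intro hl
        rcases lt_trichotomy a b with hab | rfl | hab
        · exact key a b hab hl
        · rfl
        · exact (key b a hab hl.symm).symm
      · intro a b hab hl
        obtain ⟨i, ⟨e1, e2⟩ | ⟨e1, e2⟩⟩ := exists_link (hadj a b hab hl)
        · have hi : i ∈ I := by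
            rw [hI, ← e1, ← e2, W.inv_apply_self, W.inv_apply_self, hl]
          rw [e1, e2, labelInt_ptSucc hi]
        · have e3 : pt i = y.1 (-b) := by rw [W.apply_neg, e2, Pt.neg_neg]
          have e4 : ptSucc i = y.1 (-a) := by rw [W.apply_neg, e1, Pt.neg_neg]
          have hi : i ∈ I := by
            rw [hI, e3, e4, W.inv_apply_self, W.inv_apply_self, labelInt_neg, labelInt_neg, hl]
          rw [e1, e2, labelInt_neg, labelInt_neg, labelInt_ptSucc hi]
    · have key := rel_of_adjacent I (fun a b => labelInt J ((y⁻¹).1 a) = labelInt J ((y⁻¹).1 b))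
        (fun _ _ _ => Eq.trans) ?_
      · intro hl
        rcases lt_trichotomy (y.1 a) (y.1 b) with hab | hab | hab
        · simpa only [W.inv_apply_self] using key _ _ hab hl
        · rw [y.1.injective hab]
        · simpa only [W.inv_apply_self] using (key _ _ hab hl.symm).symm
      · intro a b hab hl
        obtain ⟨i, hi, ⟨rfl, rfl⟩ | ⟨rfl, rfl⟩⟩ := exists_link_mem hab hl
        · exact (hI i).mp hi
        · rw [W.apply_neg, W.apply_neg, labelInt_neg, labelInt_neg, (hI i).mp hi]
    · rw [hy, W.mul_apply, W.mul_apply]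
      refine longest_antitone (longest_antitone hab hl) (labelInt_eq_of_subset hsub ?_)
      rw [labelInt_longest, labelInt_longest, hl]
  -- The element `y` preserves the labels of `insert t J`, so points of one component of `J` have
  -- images with equal labels there. Comparing cardinalities then shows that exactly one element of
  -- `insert t J` is missing from `I`.
  have hIK : I ⊆ insert t J := by
    intro i hi
    apply mem_of_labelInt_eq
    have h1 := labelInt_eq_of_subset hsub ((hI i).mp hi)
    rwa [← hyK', W.apply_inv_self, ← hyK' ((y⁻¹).1 (ptSucc i)), W.apply_inv_self] at h1
  refine ⟨I, y, hblock, ?_, ⟨t, ht, rfl⟩, ?_⟩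
  · obtain ⟨s, hs, e⟩ := Finset.exists_eq_insert_iff.mpr
      ⟨hIK, by rw [hblock.card_eq, Finset.card_insert_of_notMem ht]⟩
    exact ⟨s, hs, e.symm⟩
  · rw [hy, mul_assoc, longest_mul_self, mul_one]

/-! ### Links and block permutations with prescribed squash -/

theorem exists_gap {n : ℕ} (J : Finset (Fin n)) (b : ℕ) (hb : b ≤ n) (c : ℕ) (hc : c < gaps J b) :
    ∃ t : Fin n, t ∉ J ∧ gaps J t = c := by
  induction b with
  | zero => rw [gaps_zero] at hc; omega
  | succ b ih =>
    have h := gaps_succ J ⟨b, hb⟩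
    simp only at h
    by_cases hJ : (⟨b, hb⟩ : Fin n) ∈ J
    · rw [if_pos hJ] at h
      exact ih (by omega) (by omega)
    · rw [if_neg hJ] at h
      by_cases e : gaps J b = c
      · exact ⟨⟨b, hb⟩, hJ, e⟩
      · exact ih (by omega) (by omega)

theorem exists_isLink_right {n k : ℕ} {J : Finset (Fin n)} (hJ : J.card + k = n) (c : Fin k) :
    ∃ I K y, IsLink I K J y ∧ squash k (cosetOf I J y) = simple c := by
  have h1 := gaps_top J
  obtain ⟨t, ht, e⟩ := exists_gap J n le_rfl c (by have := c.2; omega)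
  obtain ⟨I, y, h⟩ := exists_isLink ht
  exact ⟨I, _, y, h, h.squash_eq_simple ht hJ e.symm⟩

theorem exists_isLink_left {n k : ℕ} {I : Finset (Fin n)} (hI : I.card + k = n) (c : Fin k) :
    ∃ K J y, IsLink I K J y ∧ squash k (cosetOf I J y) = simple c := by
  obtain ⟨J, K, y, h, e⟩ := exists_isLink_right hI c
  exact ⟨K, J, y⁻¹, h.inv, by rw [h.block.squash_inv hI, e, simple_inv]⟩

/-- A word for `σ` is built up from the right: each new letter is the squash of a link starting at
the set reached so far. -/
theorem exists_isBlock_squash {n k : ℕ} {J : Finset (Fin n)} (hJ : J.card + k = n) (σ : W k) :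
    ∃ I y, IsBlock I J y ∧ squash k (cosetOf I J y) = σ := by
  obtain ⟨ω, rfl, -⟩ := exists_word σ
  induction ω with
  | nil => exact ⟨J, 1, IsBlock.one J, IsBlock.squash_one hJ⟩
  | cons c ω ih =>
    obtain ⟨I, y, h, e⟩ := ih
    obtain ⟨I', K, z, h', e'⟩ := exists_isLink_right (h.card_add hJ) c
    exact ⟨I', z * y, h'.block.mul h, by
      rw [h'.block.squash_mul h (h.card_add hJ), e, e', List.map_cons, List.prod_cons]⟩

/-! ### Atomic cosets and links -/

namespace Coset

variable {n k : ℕ} {I J K : Finset (Fin n)} {p : Coset I J}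

theorem IsAtomic.exists_max_eq (h : p.IsAtomic) :
    ∃ s, s ∉ I ∧ p.max = longest (insert s I) ∧ ∃ t ∈ insert s I, J = (insert s I).erase t := by
  obtain ⟨-, s, t, hs, ht, ⟨h1, h2, -⟩, h3, -⟩ := h
  have hJ : (insert s I).erase t = J := by simpa using h2
  refine ⟨s, hs, ?_, t, ht, hJ.symm⟩
  have hn : ¬ insert s I ⊆ (insert s I).erase t := fun hn => by simpa using hn ht
  rw [stepProd, stepProd, if_pos (Finset.subset_insert _ _), if_neg hn] at h3
  simpa [stepProd] using h3

theorem IsAtomic.exists_isLink (h : p.IsAtomic) : ∃ s, IsLink I (insert s I) J p.min := by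
  obtain ⟨s, hs, hmax, t, ht, e⟩ := h.exists_max_eq
  refine ⟨s, h.1.isBlock, ⟨s, hs, rfl⟩, ⟨t, ?_, ?_⟩, by rw [← h.1.max_eq, hmax]⟩
  · rw [e]; exact Finset.notMem_erase _ _
  · rw [e, Finset.insert_erase ht]

/-- A reduced expression `[I, K, J]` of an atomic coset ascends and then descends. -/
theorem IsAtomic.isLink (h : p.IsAtomic) (hK : IsReducedExpr p [I, K, J]) :
    IsLink I K J p.min := by
  obtain ⟨s, hl⟩ := h.exists_isLink
  have hmax : p.max = longest (insert s I) := by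
    rw [h.1.max_eq, hl.mul_longest_eq]
  obtain ⟨⟨-, -, hchain⟩, hp, -⟩ := hK
  have hcard := h.1.isBlock.card_eq
  have hs : s ∉ I := by
    obtain ⟨s', hs', e⟩ := hl.left
    intro hs
    rw [Finset.insert_eq_of_mem hs] at e
    exact hs' (by rw [e]; exact Finset.mem_insert_self _ _)
  have hstep : IsStep I K := by
    simp at hchain; exact hchain.1
  rw [stepProd, stepProd] at hp
  simp only [stepProd, mul_one] at hp
  rcases hstep with ⟨s', hs', rfl⟩ | ⟨s', hs', rfl⟩
  · have hn : ¬ insert s' I ⊆ J := by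
      intro hn
      have := Finset.card_le_card hn
      rw [Finset.card_insert_of_notMem hs'] at this
      omega
    rw [if_pos (Finset.subset_insert _ _), if_neg hn, hmax] at hp
    simp only [mul_one, mul_inv_cancel_left] at hp
    rwa [longest_injective hp] at hl
  -- If the expression descended first, an ascent to `J` would put `p.min` into `W_I`, so the coset
  -- would contain `1` and `p.min = 1`, whence `w_J` would be the longest element of a larger set.
  -- Without an ascent, `p.max` would be `w_I`, again too small.
  · exfalso
    have hn : ¬ I ⊆ I.erase s' := fun hn => by simpa using hn hs'
    rw [if_neg hn, one_mul] at hp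
    split_ifs at hp with hsub
    · have hmin : p.min = longest I * (longest (I.erase s'))⁻¹ := by
        rw [h.1.max_eq, ← mul_assoc] at hp
        exact mul_right_cancel hp
      have hmem : p.min ∈ parabolic I := by
        rw [hmin]
        exact mul_mem (longest_spec I).1
          (inv_mem (parabolic_mono (Finset.erase_subset _ _) (longest_spec _).1))
      have h1 : (1 : W n) ∈ p.carrier := by
        have : (1 : W n) ∈ (cosetOf I J p.min).carrier :=
          DoubleCoset.mem_doubleCoset.mpr ⟨_, inv_mem hmem, 1, one_mem _, by simp⟩
        rwa [← p.eq_cosetOf_min] at this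
      have h2 := p.min_spec.2 1 h1
      rw [len_one] at h2
      have h3 := hl.mul_longest_eq
      rw [eq_one_of_len (Nat.le_zero.mp h2), one_mul] at h3
      exact hl.not_subset (by rw [← longest_injective h3])
    · rw [mul_one, hmax] at hp
      exact hs (by rw [← longest_injective hp]; exact Finset.mem_insert_self _ _)

end Coset

/-! ### Atomic expressions -/

theorem IsAtomicExpr.ne_nil {n : ℕ} {L : List (Finset (Fin n))} (h : IsAtomicExpr L) : L ≠ [] := by
  cases h <;> simp

theorem exists_map_simple {k : ℕ} {l : List (W k)} (h : ∀ s ∈ l, s ∈ Set.range (simple (n := k))) :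
    ∃ v : List (Fin k), v.map simple = l :=
  (Set.range_list_map (simple (n := k))).superset h

/-- The data that an atomic expression from `I` to `J` determines: the product `y` of the minimal
elements of its atomic cosets, and the sum `N` of their lengths. -/
theorem IsAtomicExpr.exists_isBlock {n k : ℕ} {L : List (Finset (Fin n))} (h : IsAtomicExpr L)
    {I J : Finset (Fin n)} (hhead : L.head? = some I) (hlast : L.getLast? = some J)
    (hI : I.card + k = n) :
    ∃ y, IsBlock I J y ∧ squash k (cosetOf I J y) = (squashExpr k L).prod ∧
      longest I * stepProd L = y * longest J ∧
      (∀ s ∈ squashExpr k L, s ∈ Set.range (simple : Fin k → W k)) ∧ L.IsChain IsStep ∧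
      ∃ N : ℕ, len (longest I) + stepLen L = N + len (longest J) ∧ len y ≤ N ∧
        (len y = N ↔ len (squash k (cosetOf I J y)) = (squashExpr k L).length) := by
  induction h generalizing I with
  | base I' =>
    obtain rfl : I' = I := by simpa using hhead
    obtain rfl : I' = J := by simpa using hlast
    refine ⟨1, IsBlock.one _, ?_, ?_, ?_, by simp, 0, ?_, ?_, ?_⟩
    · rw [IsBlock.squash_one hI]; simp [squashExpr]
    · simp [stepProd]
    · simp [squashExpr]
    · simp [stepLen]
    · rw [len_one]
    · rw [IsBlock.squash_one hI]; simp [squashExpr, len_one]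
  | cons I₀ K I' L a ha hK hL ih =>
    obtain rfl : I₀ = I := by simpa using hhead
    have hl := ha.isLink hK
    generalize a.min = y at hl
    have hI' : I'.card + k = n := by rw [← hl.block.card_eq, hI]
    obtain ⟨z, hz, e1, e2, e3, e4, N, e5, e6, e7⟩ := ih (I := I') rfl (by simpa using hlast) hI'
    obtain ⟨c, hc⟩ := hl.exists_squash_eq_simple hI'
    have hsq : squashExpr k (I₀ :: K :: I' :: L) = simple c :: squashExpr k (I' :: L) := by
      rw [squashExpr, hl.cosetOf_longest, hc]
    have hmul : squash k (cosetOf I₀ J (y * z)) = simple c * squash k (cosetOf I' J z) := by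
      rw [hl.block.squash_mul hz hI', hc]
    have hiff := hl.block.len_mul_eq_iff_squash hz hI'
    rw [hc, len_simple] at hiff
    have hle := len_mul_le y z
    have hle' := len_mul_le (simple c) (squash k (cosetOf I' J z))
    rw [len_simple] at hle'
    have hle2 : len (squash k (cosetOf I' J z)) ≤ (squashExpr k (I' :: L)).length := by
      rw [e1]
      obtain ⟨v, hv⟩ := exists_map_simple e3
      have := invSum_prod_le v
      rw [hv, ← four_mul_len] at this
      rw [← hv, List.length_map, hv]
      omega
    have hlen := hl.block.len_mul (longest_spec I').1
    rw [hl.mul_longest_eq] at hlen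
    refine ⟨y * z, hl.block.mul hz, ?_, ?_, ?_, ?_, len y + N, ?_, by omega, ?_⟩
    · rw [hmul, hsq, e1, List.prod_cons]
    · rw [hl.stepProd_cons, mul_assoc y, ← e2, ← mul_assoc y, hl.mul_longest_eq]
      group
    · intro s hs
      rw [hsq, List.mem_cons] at hs
      rcases hs with rfl | hs
      · exact ⟨c, rfl⟩
      · exact e3 s hs
    · simp only [List.isChain_cons_cons]
      exact ⟨hl.isStep_left, hl.isStep_right, e4⟩
    · rw [hl.stepLen_cons, hlen]
      push_cast
      linarith
    -- Equality on either side means that subadditivity is sharp both at the first factor and in the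
    -- tail; `hiff` matches the former and `e7` the latter.
    · rw [hmul, hsq, List.length_cons]
      omega

/-- An atomic expression of the right product and target type is reduced exactly if the squashed
word is. -/
theorem IsAtomicExpr.isReducedExpr_iff {n k : ℕ} {L : List (Finset (Fin n))} (h : IsAtomicExpr L)
    {I J : Finset (Fin n)} (hhead : L.head? = some I) (hI : I.card + k = n) {p : Coset I J}
    (hp : p.IsCore) :
    IsReducedExpr p L ↔ IsOrdinaryReducedExpr (squash k p) (squashExpr k L) := by
  have hJ : J.card + k = n := by rw [← hp.isBlock.card_eq, hI]
  constructor
  · rintro ⟨⟨-, hlast, -⟩, h1, h2⟩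
    obtain ⟨y, hy, e1, e2, e3, e4, N, e5, e6, e7⟩ := h.exists_isBlock hhead hlast hI
    have hpy : p.min = y := by
      rw [e2, hp.max_eq] at h1
      exact mul_right_cancel h1
    rw [p.squash_eq, hpy]
    refine ⟨e3, e1.symm, (e7.mp ?_).symm⟩
    rw [e5, hp.max_eq, hpy, hy.len_mul (longest_spec J).1] at h2
    push_cast at h2
    omega
  · rintro ⟨h1, h2, h3⟩
    obtain ⟨J', hlast⟩ : ∃ J', L.getLast? = some J' :=
      ⟨_, List.getLast?_eq_some_getLast h.ne_nil⟩
    obtain ⟨y, hy, e1, e2, e3, e4, N, e5, e6, e7⟩ := h.exists_isBlock hhead hlast hI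
    -- The endpoint `J'` of the expression is not given in advance; the initial set and the product
    -- of the word force it to be `J`.
    obtain ⟨hpy, rfl⟩ := hp.isBlock.eq_of_squash_left hy hI (by rw [← p.squash_eq, ← h2, e1])
    rw [p.squash_eq, hpy] at h3
    refine ⟨⟨hhead, hlast, e4⟩, by rw [hp.max_eq, hpy, e2], ?_⟩
    rw [e5, hp.max_eq, hpy, hy.len_mul (longest_spec J).1, e7.mpr h3.symm]
    push_cast; rfl

/-- The initial set and the first letter determine the link `y` and the next set `I'`, hence `K`
through `w_K = y w_{I'}`; the rest follows by induction. -/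
theorem IsAtomicExpr.eq_of_squashExpr_eq {n k : ℕ} {L : List (Finset (Fin n))}
    (h : IsAtomicExpr L) {I : Finset (Fin n)} (hhead : L.head? = some I) (hI : I.card + k = n)
    {L' : List (Finset (Fin n))} (h' : IsAtomicExpr L') (hhead' : L'.head? = some I)
    (hs : squashExpr k L = squashExpr k L') : L = L' := by
  induction h generalizing I L' with
  | base I₀ =>
    obtain rfl : I₀ = I := by simpa using hhead
    cases h' with
    | base I₁ => simpa using hhead'.symm
    | cons I₁ K I' L a ha hK hL => simp [squashExpr] at hs
  | cons I₀ K I₁ L a ha hK hL ih =>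
    obtain rfl : I₀ = I := by simpa using hhead
    cases h' with
    | base I₁ => simp [squashExpr] at hs
    | cons I₀' K' I₁' L' a' ha' hK' hL' =>
      obtain rfl : I₀' = I₀ := by simpa using hhead'
      have hl := ha.isLink hK
      have hl' := ha'.isLink hK'
      rw [squashExpr, squashExpr, hl.cosetOf_longest, hl'.cosetOf_longest, List.cons.injEq] at hs
      obtain ⟨hmin, rfl⟩ := hl.block.eq_of_squash_left hl'.block hI hs.1
      have hKK : K = K' := by
        apply longest_injective
        rw [← hl.mul_longest_eq, ← hl'.mul_longest_eq, hmin]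
      rw [hKK, ih rfl (by rw [← hl.block.card_eq, hI]) hL' rfl hs.2]

/-- All sets reached have the same size as `I`, so from each of them every letter of `ω` is
available as a link. -/
theorem exists_isAtomicExpr {n k : ℕ} (ω : List (Fin k)) {I : Finset (Fin n)}
    (hI : I.card + k = n) :
    ∃ L, IsAtomicExpr L ∧ L.head? = some I ∧ squashExpr k L = ω.map simple := by
  induction ω generalizing I with
  | nil => exact ⟨[I], .base I, rfl, rfl⟩
  | cons c ω ih =>
    obtain ⟨K, J, y, h, e⟩ := exists_isLink_left hI c
    obtain ⟨L, h1, h2, h3⟩ := ih (I := J) (by rw [← h.block.card_eq, hI])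
    obtain ⟨L, rfl⟩ : ∃ L', L = J :: L' := by
      cases L with
      | nil => simp at h2
      | cons J' L => exact ⟨L, by simpa using h2⟩
    refine ⟨I :: K :: J :: L, .cons I K J L _ h.isAtomic h.isReducedExpr h1, rfl, ?_⟩
    rw [squashExpr, h.cosetOf_longest, e, h3, List.map_cons]

end TypeB

end

/-! ### The five assertions -/

theorem mainTheorem7 (n m k : ℕ) (J : Finset (Fin n)) (hm : J.card = m) (hk : k = n - m) :
    -- minimal elements of core cosets are block permutations, so that squashing makes sense
    (∀ (I : Finset (Fin n)) (p : TypeB.Coset I J), p.IsCore →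
      I.card = m ∧ TypeB.IsBlock I J p.min) ∧
    -- reduced compositions of core cosets are sent to reduced compositions
    (∀ (I K : Finset (Fin n)) (p' : TypeB.Coset I J) (p'' : TypeB.Coset J K),
      p'.IsCore → p''.IsCore → p'.IsReducedComp p'' →
      (p'.comp p'').IsCore ∧
      TypeB.squash k (p'.comp p'') = TypeB.squash k p' * TypeB.squash k p'' ∧
      TypeB.len (TypeB.squash k p' * TypeB.squash k p'') =
        TypeB.len (TypeB.squash k p') + TypeB.len (TypeB.squash k p'')) ∧
    -- squashing is a bijection from the pairs `(I, p)` with `p` core to `W_k`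
    Set.BijOn (fun q : (Σ I : Finset (Fin n), TypeB.Coset I J) => TypeB.squash k q.2)
      {q | q.2.IsCore} Set.univ ∧
    -- it restricts to a bijection from atomic cosets to simple reflections
    Set.BijOn (fun q : (Σ I : Finset (Fin n), TypeB.Coset I J) => TypeB.squash k q.2)
      {q | q.2.IsAtomic} (Set.range (TypeB.simple : Fin k → TypeB.W k)) ∧
    -- atomic reduced expressions correspond bijectively to ordinary reduced expressions
    (∀ (I : Finset (Fin n)) (p : TypeB.Coset I J), p.IsCore →
      Set.BijOn (TypeB.squashExpr k) {L | TypeB.IsAtomicReducedExpr p L}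
        {ω | TypeB.IsOrdinaryReducedExpr (TypeB.squash k p) ω}) := by
  have hJ : J.card + k = n := by
    have := Finset.card_le_univ J
    rw [Fintype.card_fin] at this
    omega
  have hinj : Set.InjOn (fun q : (Σ I : Finset (Fin n), TypeB.Coset I J) => TypeB.squash k q.2)
      {q | q.2.IsCore} := by
    rintro ⟨I, p⟩ hp ⟨I', p'⟩ hp' h
    have hp : p.IsCore := hp
    have hp' : p'.IsCore := hp'
    have h : TypeB.squash k p = TypeB.squash k p' := h
    rw [p.squash_eq, p'.squash_eq] at h
    obtain ⟨h1, rfl⟩ := hp.isBlock.eq_of_squash_right hp'.isBlock hJ h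
    rw [p.eq_cosetOf_min, p'.eq_cosetOf_min, h1]
  refine ⟨fun I p hp => ⟨hp.isBlock.card_eq.trans hm, hp.isBlock⟩, ?_, ⟨fun _ _ => trivial, hinj, ?_⟩,
    ⟨?_, hinj.mono fun q hq => hq.1, ?_⟩, ?_⟩
  · rintro I K p' p'' hp' hp'' ⟨h1, h2, -⟩
    have hb := hp'.isBlock
    have hb' := hp''.isBlock
    have e : p'.max * (TypeB.longest J)⁻¹ = p'.min := by
      rw [hp'.max_eq, mul_inv_cancel_right]
    -- For a reduced composition the star product is `p'.min * p''.min * w_K`, which lies in the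
    -- coset of the block permutation `p'.min * p''.min`.
    have hcomp : p'.comp p'' = TypeB.cosetOf I K (p'.min * p''.min) := by
      refine ((TypeB.cosetOf I K (p'.min * p''.min)).eq_cosetOf_of_mem ?_).symm
      rw [(hb.mul hb').mem_carrier_iff, ← h1, e, hp''.max_eq]
      exact ⟨_, (TypeB.longest_spec K).1, by group⟩
    rw [hcomp, p'.squash_eq, p''.squash_eq]
    refine ⟨(hb.mul hb').isCore_cosetOf, hb.squash_mul hb' hJ,
      (hb.len_mul_eq_iff_squash hb' hJ).mp ?_⟩
    -- Both sides contain `len (longest K)`; cancelling it leaves additivity for the two minimal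
    -- elements.
    rw [e, hp''.max_eq, ← mul_assoc, (hb.mul hb').len_mul (TypeB.longest_spec K).1,
      hb'.len_mul (TypeB.longest_spec K).1] at h2
    omega
  · intro σ _
    obtain ⟨I, y, h, e⟩ := TypeB.exists_isBlock_squash hJ σ
    exact ⟨⟨I, TypeB.cosetOf I J y⟩, h.isCore_cosetOf, e⟩
  · rintro ⟨I, p⟩ hp
    obtain ⟨s, h⟩ := TypeB.Coset.IsAtomic.exists_isLink hp
    obtain ⟨c, hc⟩ := h.exists_squash_eq_simple hJ
    exact ⟨c, by rw [← hc]; exact (p.squash_eq k).symm⟩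
  · rintro _ ⟨c, rfl⟩
    obtain ⟨I, K, y, h, e⟩ := TypeB.exists_isLink_right hJ c
    exact ⟨⟨I, TypeB.cosetOf I J y⟩, h.isAtomic, e⟩
  · intro I p hp
    have hI := hp.isBlock.card_add hJ
    refine ⟨fun L hL => (hL.2.isReducedExpr_iff hL.1.1.1 hI hp).mp hL.1, fun L hL L' hL' h =>
      hL.2.eq_of_squashExpr_eq hL.1.1.1 hI hL'.2 hL'.1.1.1 h, fun ω hω => ?_⟩
    obtain ⟨v, rfl⟩ := TypeB.exists_map_simple hω.1
    obtain ⟨L, h1, h2, h3⟩ := TypeB.exists_isAtomicExpr v hI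
    exact ⟨L, ⟨(h1.isReducedExpr_iff h2 hI hp).mpr (by rw [h3]; exact hω), h1⟩, h3⟩
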